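/- Let $k$ be a field and $X$ a scheme of finite type over $k$. For a coherent sheaf $\mathcal E$ on $X$ let $E=L(\mathcal E)=\operatorname{Spec}_X(\operatorname{Sym}\mathcal E)$ be the corresponding linear space over $X$; homomorphisms $E\to F$ of linear spaces are the morphisms $L(\varphi)$ induced by homomorphisms $\varphi:\mathcal F\to\mathcal E$ of coherent sheaves, so that $\mathcal E\mapsto L(\mathcal E)$ identifies the category $\mathrm{Lin}(X)$ of linear spaces with the opposite of the category of coherent sheaves; $E\oplus F=L(\mathcal E\oplus\mathcal F)=E\times_X F$. A cone in $E=L(\mathcal E)$ is a closed subscheme $C\subset E$ of the form $\operatorname{Spec}_X S^\bullet$ with $S^\bullet$ a graded quotient algebra of $\operatorname{Sym}\mathcal E$ such that $S^0=\mathcal O_X$. For a homomorphism $D:E\to F$ of linear spaces, an $E$-cone in $F$ is a cone $C\subset F$ preserved by the additive action $\alpha=D\circ\mathrm{pr}_1+\mathrm{pr}_2:E\oplus F\to F$ of $E$ on $F$, i.e. $E\oplus C\subset\alpha^{-1}(C)$. A two-term complex is a homomorphism $F_\bullet=[F_0\to F_1]$ of linear spaces, and a morphism $\Phi_\bullet=(\Phi_0,\Phi_1):F_\bullet\to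 E_\bullet$ is a commutative square. It is a quasi-isomorphism if it induces isomorphisms on $H^0$ (kernels) and $H^1$ (cokernels), taken in $\mathrm{Lin}(X)$; equivalently, the induced maps between the cokernels and between the kernels of the corresponding maps of coherent sheaves are isomorphisms. Let $\Phi_\bullet:F_\bullet\to E_\bullet$ be a quasi-isomorphism of two-term complexes of linear spaces over $X$ with $F_0$ locally free (a vector bundle). Let $D:E_0\to E_1$ be the differential of $E_\bullet$ and $q=D\circ\mathrm{pr}_1+\Phi_1\circ\mathrm{pr}_2:E_0\oplus F_1\to E_1$. Then: 1. For every $F_0$-cone $C\subset F_1$ there is a unique cone $(\Phi_\bullet)_!(C)\subset E_1$ with $q^{-1}\big((\Phi_\bullet)_!(C)\big)=E_0\oplus C$ (going down). 2. Going down, $C\mapsto(\Phi_\bullet)_!(C)$, and going up, $\bar C\mapsto\Phi_\bullet^!(\bar C):=\Phi_1^{-1}(\bar C)$ (scheme-theoretic preimage), are mutually inverse bijections between the set of $F_0$-cones in $F_1$ and the set of $E_0$-cones in $E_1$. 3. These bijections are functorial: $\mathrm{id}^!(C)=C=\mathrm{id}_!(C)$ for every $F_0$-cone $C\subset F_1$,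 and if $\Psi_\bullet:G_\bullet\to F_\bullet$ is another quasi-isomorphism of two-term complexes of linear spaces with $G_0$ locally free, then $(\Phi_\bullet\circ\Psi_\bullet)^!(\bar C)=\Psi_\bullet^!\Phi_\bullet^!(\bar C)$ for every $E_0$-cone $\bar C\subset E_1$ and $(\Phi_\bullet\circ\Psi_\bullet)_!(C)=(\Phi_\bullet)_!(\Psi_\bullet)_!(C)$ for every $G_0$-cone $C\subset G_1$. -/

import Mathlib

open CategoryTheory Limits AlgebraicGeometry
universe u

noncomputable section

section Algebra

/-- The ring homomorphism on symmetric algebras induced by a semilinear map. -/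
def symMap {R R' M M' : Type*} [CommRing R] [CommRing R'] [AddCommGroup M] [AddCommGroup M']
    [Module R M] [Module R' M'] (σ : R →+* R') (g : M →ₛₗ[σ] M') :
    SymmetricAlgebra R M →+* SymmetricAlgebra R' M' :=
  letI : Algebra R (SymmetricAlgebra R' M') :=
    ((algebraMap R' (SymmetricAlgebra R' M')).comp σ).toAlgebra
  (SymmetricAlgebra.lift
    ({ toFun := fun m => SymmetricAlgebra.ι R' M' (g m)
       map_add' := fun a b => by simp
       map_smul' := fun r m => by
        rw [map_smulₛₗ, map_smul, Algebra.smul_def, Algebra.smul_def]; rfl } :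
      M →ₗ[R] SymmetricAlgebra R' M')).toRingHom

section
variable {R R' M M' : Type*} [CommRing R] [CommRing R'] [AddCommGroup M] [AddCommGroup M']
    [Module R M] [Module R' M'] (σ : R →+* R') (g : M →ₛₗ[σ] M')

@[simp] lemma symMap_ι (m : M) :
    symMap σ g (SymmetricAlgebra.ι R M m) = SymmetricAlgebra.ι R' M' (g m) := by
  let : Algebra R (SymmetricAlgebra R' M') :=
    ((algebraMap R' (SymmetricAlgebra R' M')).comp σ).toAlgebra
  exact SymmetricAlgebra.lift_ι_apply _ _

@[simp] lemma symMap_algebraMap (r : R) :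
    symMap σ g (algebraMap R _ r) = algebraMap R' _ (σ r) := by
  let : Algebra R (SymmetricAlgebra R' M') :=
    ((algebraMap R' (SymmetricAlgebra R' M')).comp σ).toAlgebra
  exact AlgHom.commutes (SymmetricAlgebra.lift _) r

lemma symRingHom_ext {A : Type*} [CommRing A] {p q : SymmetricAlgebra R M →+* A}
    (h₀ : ∀ r, p (algebraMap R _ r) = q (algebraMap R _ r))
    (h₁ : ∀ m, p (SymmetricAlgebra.ι R M m) = q (SymmetricAlgebra.ι R M m)) : p = q := by
  refine RingHom.ext fun x => ?_
  induction x using SymmetricAlgebra.induction with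
  | algebraMap r => exact h₀ r
  | ι m => exact h₁ m
  | mul a b ha hb => rw [map_mul, map_mul, ha, hb]
  | add a b ha hb => rw [map_add, map_add, ha, hb]
end

lemma symMap_isLocalization {R R' M M' : Type*} [CommRing R] [CommRing R'] [AddCommGroup M]
    [AddCommGroup M'] [Module R M] [Module R' M'] (σ : R →+* R') (g : M →ₛₗ[σ] M') (f : R)
    (hR : letI := σ.toAlgebra; IsLocalization.Away f R')
    (hs : ∀ y : M', ∃ (n : ℕ) (x : M), g x = σ f ^ n • y)
    (hi : ∀ x : M, g x = 0 → ∃ n : ℕ, f ^ n • x = 0) :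
    letI := (symMap σ g).toAlgebra
    IsLocalization.Away (algebraMap R (SymmetricAlgebra R M) f) (SymmetricAlgebra R' M') := by
  let aR := σ.toAlgebra
  let mR : Module R M' := Module.compHom M' σ
  have : IsScalarTower R R' M' := ⟨fun a b c => by
    rw [Algebra.smul_def, mul_smul]; rfl⟩
  let gl : M →ₗ[R] M' := { g with map_smul' := fun r m => g.map_smulₛₗ r m }
  have hu : IsUnit (σ f) := IsLocalization.Away.algebraMap_isUnit (S := R') f
  have hg : IsLocalizedModule (.powers f) gl := by
    refine ⟨?_, ?_, ?_⟩
    · rintro ⟨_, n, rfl⟩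
      rw [Module.End.isUnit_iff]
      have : IsUnit (σ (f ^ n)) := by rw [map_pow]; exact hu.pow n
      have h2 := (Module.End.isUnit_iff _).mp (this.map (algebraMap R' (Module.End R' M')))
      exact h2
    · intro y
      obtain ⟨n, x, h⟩ := hs y
      exact ⟨(x, ⟨f ^ n, n, rfl⟩), by
        change σ (f ^ n) • y = g x
        rw [h, map_pow]⟩
    · intro a b h
      obtain ⟨n, hn⟩ := hi (a - b) (by
        rw [map_sub]; exact sub_eq_zero.mpr h)
      exact ⟨⟨f ^ n, n, rfl⟩, by
        change f ^ n • a = f ^ n • b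
        rw [smul_sub] at hn; exact sub_eq_zero.mp hn⟩
  let S := SymmetricAlgebra R M
  let F : S := algebraMap R S f
  let L := Localization.Away F
  let aS := (symMap σ g).toAlgebra
  have hF : IsUnit (algebraMap R L f) := by
    rw [IsScalarTower.algebraMap_apply R S L]
    exact IsLocalization.Away.algebraMap_isUnit (S := L) F
  -- the inverse map
  let τ : R' →+* L := IsLocalization.Away.lift (S := R') f (g := algebraMap R L) hF
  have hτ : ∀ r, τ (σ r) = algebraMap R L r := fun r =>
    IsLocalization.Away.lift_eq (S := R') f hF r
  let aL : Algebra R' L := τ.toAlgebra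
  have : IsScalarTower R R' L := IsScalarTower.of_algebraMap_eq (fun r => (hτ r).symm)
  let j0 : M →ₗ[R] L := (IsScalarTower.toAlgHom R S L).toLinearMap ∘ₗ SymmetricAlgebra.ι R M
  have hunits : ∀ x : Submonoid.powers f, IsUnit ((algebraMap R (Module.End R L)) x) := by
    rintro ⟨_, n, rfl⟩
    rw [Module.End.isUnit_iff]
    have : IsUnit (algebraMap R L (f ^ n)) := by rw [map_pow]; exact hF.pow n
    have h2 := (Module.End.isUnit_iff _).mp (this.map (algebraMap L (Module.End L L)))
    have e : ∀ x : L, algebraMap L (Module.End L L) (algebraMap R L (f ^ n)) x =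
        algebraMap R (Module.End R L) (f ^ n) x := fun x => by
      rw [Module.algebraMap_end_apply, Module.algebraMap_end_apply, Algebra.smul_def,
        Algebra.smul_def]; rfl
    rwa [show (⇑(algebraMap L (Module.End L L) (algebraMap R L (f ^ n))) : L → L) =
      ⇑(algebraMap R (Module.End R L) (f ^ n)) from funext e] at h2
  let j1 : M' →ₗ[R] L := IsLocalizedModule.lift (.powers f) gl j0 hunits
  have hj1 : ∀ m, j1 (g m) = algebraMap S L (SymmetricAlgebra.ι R M m) := fun m =>
    IsLocalizedModule.lift_apply (.powers f) gl j0 hunits m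
  let j2 : M' →ₗ[R'] L := IsLocalization.linearMap_compatibleSMul (.powers f) R' M' L |>.map_smul j1 |> fun h =>
    { j1 with map_smul' := h }
  let Ψ : SymmetricAlgebra R' M' →ₐ[R'] L := SymmetricAlgebra.lift j2
  have hΨι : ∀ m, Ψ (SymmetricAlgebra.ι R' M' m) = j1 m := fun m =>
    SymmetricAlgebra.lift_ι_apply _ _
  have hFu : IsUnit (symMap σ g F) := by
    rw [symMap_algebraMap]; exact hu.map _
  let Φ : L →+* SymmetricAlgebra R' M' := IsLocalization.Away.lift (S := L) F hFu
  have hΦ : ∀ s, Φ (algebraMap S L s) = symMap σ g s := fun s =>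
    IsLocalization.Away.lift_eq (S := L) F hFu s
  have hΨs : ∀ s, Ψ (symMap σ g s) = algebraMap S L s := by
    intro s
    have : (Ψ : SymmetricAlgebra R' M' →+* L).comp (symMap σ g) = algebraMap S L := by
      apply symRingHom_ext
      · intro r
        simp only [RingHom.comp_apply, symMap_algebraMap]
        change Ψ (algebraMap R' _ (σ r)) = _
        rw [AlgHom.commutes]
        exact hτ r
      · intro m
        simp only [RingHom.comp_apply, symMap_ι]
        exact (hΨι _).trans (hj1 m)
    exact congr($this s)
  have h1 : (Ψ : SymmetricAlgebra R' M' →+* L).comp Φ = RingHom.id L := by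
    apply IsLocalization.ringHom_ext (Submonoid.powers F)
    ext s
    simp only [RingHom.comp_apply, RingHom.id_apply]
    rw [hΦ]; exact hΨs s
  have h2 : Φ.comp (Ψ : SymmetricAlgebra R' M' →+* L) = RingHom.id _ := by
    have hr : ∀ r, Φ (τ r) = algebraMap R' _ r := by
      have : Φ.comp τ = algebraMap R' (SymmetricAlgebra R' M') := by
        apply IsLocalization.ringHom_ext (Submonoid.powers f)
        ext r
        simp only [RingHom.comp_apply]
        change Φ (τ (σ r)) = algebraMap R' _ (σ r)
        rw [hτ, IsScalarTower.algebraMap_apply R S L, hΦ, symMap_algebraMap]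
      exact fun r => congr($this r)
    apply symRingHom_ext
    · intro r
      simp only [RingHom.comp_apply, RingHom.id_apply]
      change Φ (Ψ (algebraMap R' _ r)) = _
      rw [AlgHom.commutes]
      exact hr r
    · intro y
      simp only [RingHom.comp_apply, RingHom.id_apply]
      obtain ⟨n, x, h⟩ := hs y
      have hun : IsUnit (algebraMap R' (SymmetricAlgebra R' M') (σ f ^ n)) := (hu.pow n).map _
      apply hun.mul_left_cancel
      rw [← hr, ← map_mul]
      have e : τ (σ f ^ n) * (Ψ : SymmetricAlgebra R' M' →+* L) (SymmetricAlgebra.ι R' M' y) =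
          algebraMap S L (SymmetricAlgebra.ι R M x) := by
        rw [← hj1, h]
        change _ = j2 (σ f ^ n • y)
        rw [map_smul, Algebra.smul_def]
        congr 1
        exact hΨι y
      rw [e, hΦ, symMap_ι, h, map_smul, Algebra.smul_def, hr]
  exact IsLocalization.isLocalization_of_algEquiv (Submonoid.powers F) (S := L)
    (AlgEquiv.ofRingEquiv (f := RingEquiv.ofRingHom Φ (Ψ : SymmetricAlgebra R' M' →+* L) h2 h1)
      (fun s => hΦ s))
end Algebra

namespace AlgebraicGeometry
open Opposite

variable {X : Scheme.{u}}

/-- On affine opens `U`, the sections of `M` over `D(f) ⊆ U` are the localization `Γ(M, U)_f`. This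
holds for every quasi-coherent module, see the instance below; it is exactly what is needed to glue
the spectra of the symmetric algebras of `Γ(M, U)`. -/
class IsLocalizingModule (M : X.Modules) : Prop where
  exists_lift : ∀ (U : X.Opens), IsAffineOpen U → ∀ (f : Γ(X, U)) (y : Γ(M, X.basicOpen f)),
    ∃ (n : ℕ) (x : Γ(M, U)), M.presheaf.map (homOfLE (X.basicOpen_le f)).op x =
      X.presheaf.map (homOfLE (X.basicOpen_le f)).op f ^ n • y
  exists_pow_smul : ∀ (U : X.Opens), IsAffineOpen U → ∀ (f : Γ(X, U)) (x : Γ(M, U)),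
    M.presheaf.map (homOfLE (X.basicOpen_le f)).op x = 0 → ∃ n : ℕ, f ^ n • x = 0

lemma modules_map_map (M : X.Modules) {U V W : X.Opens} (i : V ≤ U) (j : W ≤ V) (x : Γ(M, U)) :
    M.presheaf.map (homOfLE j).op (M.presheaf.map (homOfLE i).op x) =
      M.presheaf.map (homOfLE (j.trans i)).op x := by
  rw [← ConcreteCategory.comp_apply, ← Functor.map_comp]; rfl

lemma modules_map_rfl (M : X.Modules) {U : X.Opens} (i : U ≤ U) (x : Γ(M, U)) :
    M.presheaf.map (homOfLE i).op x = x := by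
  have : (homOfLE i).op = 𝟙 (op U) := rfl
  rw [this, CategoryTheory.Functor.map_id]; rfl

lemma localizing_aux (M : X.Modules) [M.IsQuasicoherent] (U : X.Opens) (hU : IsAffineOpen U)
    (f : Γ(X, U)) (W W' : X.Opens) (hW : W = U) (hW' : W' = X.basicOpen f) (i : W' ≤ W) :
    (∀ y : Γ(M, W'), ∃ (n : ℕ) (x : Γ(M, W)), M.presheaf.map (homOfLE i).op x =
      X.presheaf.map (homOfLE (hW'.le.trans (X.basicOpen_le f))).op f ^ n • y) ∧
    (∀ x : Γ(M, W), M.presheaf.map (homOfLE i).op x = 0 →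
      ∃ n : ℕ, X.presheaf.map (homOfLE hW.le).op f ^ n • x = 0) := by
  have e1 : hU.fromSpec ''ᵁ ⊤ = U := by simp
  have e2 : hU.fromSpec ''ᵁ (PrimeSpectrum.basicOpen f) = X.basicOpen f :=
    hU.fromSpec_image_basicOpen f
  obtain rfl : W = hU.fromSpec ''ᵁ ⊤ := hW.trans e1.symm
  obtain rfl : W' = hU.fromSpec ''ᵁ (PrimeSpectrum.basicOpen f) := hW'.trans e2.symm
  have h := (isIso_fromTildeΓ_iff_isLocalizing (M.restrict hU.fromSpec)).mp inferInstance f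
  have key : ∀ (V : (Spec Γ(X, U)).Opens) (hV : hU.fromSpec ''ᵁ V ≤ U) (n : ℕ)
      (x : Γ(M, hU.fromSpec ''ᵁ V)),
      (show Γ(M.restrict hU.fromSpec, V) from f ^ n • (show Γ(M.restrict hU.fromSpec, V) from x)) =
        X.presheaf.map (homOfLE hV).op f ^ n • x := by
    intro V hV n x
    have hring : ∀ r : Γ(X, U), (hU.fromSpec.appIso V).inv
        ((Spec Γ(X, U)).presheaf.map V.leTop.op ((Scheme.ΓSpecIso Γ(X, U)).inv r)) =
        X.presheaf.map (homOfLE hV).op r := by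
      intro r
      have hc : (Scheme.ΓSpecIso Γ(X, U)).inv ≫ (Spec Γ(X, U)).presheaf.map V.leTop.op =
          X.presheaf.map (homOfLE hV).op ≫ (hU.fromSpec.appIso V).hom := by
        rw [Scheme.Hom.appIso_hom', Scheme.Hom.map_appLE, Scheme.Hom.appLE, hU.fromSpec_app_self,
          Category.assoc, ← Functor.map_comp]
        rfl
      have := congr($hc ≫ (hU.fromSpec.appIso V).inv)
      rw [Category.assoc, Category.assoc, Iso.hom_inv_id, Category.comp_id] at this
      exact congr($this r)
    have h1 : (show Γ(M.restrict hU.fromSpec, V) from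
        f ^ n • (show Γ(M.restrict hU.fromSpec, V) from x)) =
        X.presheaf.map (homOfLE hV).op (f ^ n) • x := by
      rw [← hring]; rfl
    rw [h1, map_pow]
  refine ⟨fun y => ?_, fun x hx => ?_⟩
  · obtain ⟨⟨x, ⟨_, n, rfl⟩⟩, hx⟩ := h.surj (show Γ(M.restrict hU.fromSpec, _) from y)
    refine ⟨n, x, ?_⟩
    rw [← key _ (hW'.le.trans (X.basicOpen_le f))]
    exact hx.symm
  · have hx' : ((modulesSpecToSheaf.obj (M.restrict hU.fromSpec)).obj.map
        (PrimeSpectrum.basicOpen f).leTop.op).hom x = 0 := hx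
    obtain ⟨⟨_, n, rfl⟩, hn⟩ := (IsLocalizedModule.eq_zero_iff (.powers f) _).mp hx'
    refine ⟨n, ?_⟩
    rw [← key _ hW.le]
    exact hn

instance (M : X.Modules) [M.IsQuasicoherent] : IsLocalizingModule M where
  exists_lift U hU f y := (localizing_aux M U hU f U _ rfl rfl (X.basicOpen_le f)).1 y
  exists_pow_smul U hU f x hx := by
    obtain ⟨n, hn⟩ := (localizing_aux M U hU f U _ rfl rfl (X.basicOpen_le f)).2 x hx
    refine ⟨n, ?_⟩
    have e : X.presheaf.map (homOfLE (le_refl U)).op f = f := by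
      have : (homOfLE (le_refl U)).op = 𝟙 (op U) := rfl
      rw [this, CategoryTheory.Functor.map_id]; rfl
    rwa [e] at hn

lemma modules_app_map {M N : X.Modules} (φ : M ⟶ N) {U V : X.Opens} (i : V ≤ U) (x : Γ(M, U)) :
    φ.app V (M.presheaf.map (homOfLE i).op x) = N.presheaf.map (homOfLE i).op (φ.app U x) :=
  congr($(φ.mapPresheaf.naturality (homOfLE i).op) x)

instance (M N : X.Modules) [IsLocalizingModule M] [IsLocalizingModule N] :
    IsLocalizingModule (M ⊞ N) := by
  have tot : ∀ (U : X.Opens) (z : Γ(M ⊞ N, U)),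
      (biprod.inl : M ⟶ M ⊞ N).app U ((biprod.fst : M ⊞ N ⟶ M).app U z) +
      (biprod.inr : N ⟶ M ⊞ N).app U ((biprod.snd : M ⊞ N ⟶ N).app U z) = z := by
    intro U z
    have := congr(($(biprod.total (X := M) (Y := N))).app U z)
    exact this
  refine ⟨fun U hU f y => ?_, fun U hU f x hx => ?_⟩
  · obtain ⟨n, a, ha⟩ := IsLocalizingModule.exists_lift U hU f ((biprod.fst : M ⊞ N ⟶ M).app _ y)
    obtain ⟨m, b, hb⟩ := IsLocalizingModule.exists_lift U hU f ((biprod.snd : M ⊞ N ⟶ N).app _ y)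
    refine ⟨n + m, (biprod.inl : M ⟶ M ⊞ N).app U (f ^ m • a) +
      (biprod.inr : N ⟶ M ⊞ N).app U (f ^ n • b), ?_⟩
    rw [map_add, ← modules_app_map, ← modules_app_map, Scheme.Modules.map_smul,
      Scheme.Modules.map_smul, ha, hb, smul_smul, smul_smul, map_pow, map_pow, ← pow_add,
      ← pow_add, Scheme.Modules.Hom.app_smul, Scheme.Modules.Hom.app_smul, add_comm m n,
      ← smul_add, tot]
  · obtain ⟨n, ha⟩ := IsLocalizingModule.exists_pow_smul U hU f
      ((biprod.fst : M ⊞ N ⟶ M).app _ x) (by rw [← modules_app_map, hx, map_zero])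
    obtain ⟨m, hb⟩ := IsLocalizingModule.exists_pow_smul U hU f
      ((biprod.snd : M ⊞ N ⟶ N).app _ x) (by rw [← modules_app_map, hx, map_zero])
    refine ⟨n + m, ?_⟩
    have h1 : (biprod.fst : M ⊞ N ⟶ M).app U (f ^ (n + m) • x) = 0 := by
      rw [Scheme.Modules.Hom.app_smul, add_comm n m, pow_add, mul_smul, ha, smul_zero]
    have h2 : (biprod.snd : M ⊞ N ⟶ N).app U (f ^ (n + m) • x) = 0 := by
      rw [Scheme.Modules.Hom.app_smul, pow_add, mul_smul, hb, smul_zero]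
    rw [← tot U (f ^ (n + m) • x), h1, h2, map_zero, map_zero, add_zero]


/-- Restriction of sections of an `𝒪_X`-module, as a semilinear map. -/
def modRes (M : X.Modules) {U V : X.Opens} (i : V ≤ U) :
    Γ(M, U) →ₛₗ[(X.presheaf.map (homOfLE i).op).hom] Γ(M, V) where
  toFun x := M.presheaf.map (homOfLE i).op x
  map_add' := map_add _
  map_smul' r x := M.map_smul (homOfLE i) r x

/-- The sheaf of algebras `Sym M` on affine opens: `U ↦ Sym_{Γ(X, U)} Γ(M, U)`. -/
def symSheaf (M : X.Modules) : X.AffineZariskiSiteᵒᵖ ⥤ CommRingCat.{u} where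
  obj U := .of (SymmetricAlgebra Γ(X, U.unop.toOpens) Γ(M, U.unop.toOpens))
  map i := CommRingCat.ofHom
    (symMap _ (modRes M (Scheme.AffineZariskiSite.toOpens_mono i.unop.le)))
  map_id U := by
    refine CommRingCat.hom_ext (symRingHom_ext (fun r => ?_) (fun m => ?_))
    · refine (symMap_algebraMap _ _ r).trans ?_
      exact congrArg (algebraMap _ _) congr($(X.presheaf.map_id (op U.unop.toOpens)) r)
    · refine (symMap_ι _ _ m).trans ?_
      exact congrArg (SymmetricAlgebra.ι _ _) congr($(M.presheaf.map_id (op U.unop.toOpens)) m)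
  map_comp {U V W} i j := by
    have hi := Scheme.AffineZariskiSite.toOpens_mono i.unop.le
    have hj := Scheme.AffineZariskiSite.toOpens_mono j.unop.le
    refine CommRingCat.hom_ext (symRingHom_ext (fun r => ?_) (fun m => ?_))
    · refine (symMap_algebraMap _ _ r).trans ?_
      refine Eq.trans ?_ (congrArg (symMap _ (modRes M hj)) (symMap_algebraMap _ _ r)).symm
      refine Eq.trans ?_ (symMap_algebraMap _ _ _).symm
      exact congrArg (algebraMap _ _)
        congr($(X.presheaf.map_comp (homOfLE hi).op (homOfLE hj).op) r)
    · refine (symMap_ι _ _ m).trans ?_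
      refine Eq.trans ?_ (congrArg (symMap _ (modRes M hj)) (symMap_ι _ _ m)).symm
      refine Eq.trans ?_ (symMap_ι _ _ _).symm
      exact congrArg (SymmetricAlgebra.ι _ _)
        congr($(M.presheaf.map_comp (homOfLE hi).op (homOfLE hj).op) m)

/-- The structure morphism `𝒪_X ⟶ Sym M`. -/
def symSheafStr (M : X.Modules) :
    (Scheme.AffineZariskiSite.toOpensFunctor X).op ⋙ X.presheaf ⟶ symSheaf M where
  app U := CommRingCat.ofHom
    (algebraMap Γ(X, U.unop.toOpens) (SymmetricAlgebra Γ(X, U.unop.toOpens) Γ(M, U.unop.toOpens)))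
  naturality U V i := by
    ext r
    exact (symMap_algebraMap _ (modRes M (Scheme.AffineZariskiSite.toOpens_mono i.unop.le)) r).symm

lemma symSheafStr_coequifibered (M : X.Modules) [IsLocalizingModule M] :
    (symSheafStr M).Coequifibered := by
  rw [Scheme.AffineZariskiSite.coequifibered_iff_forall_isLocalizationAway]
  intro U f
  exact symMap_isLocalization _ (modRes M (X.basicOpen_le f)) f
    (U.2.isLocalization_basicOpen f) (IsLocalizingModule.exists_lift U.toOpens U.2 f)
    (IsLocalizingModule.exists_pow_smul U.toOpens U.2 f)

/-- The affine schemes `Spec Sym Γ(M, U) ⟶ U`, with their gluing data. -/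
def symGluing (M : X.Modules) [IsLocalizingModule M] :
    (Scheme.AffineZariskiSite.directedCover X).RelativeGluingData :=
  Scheme.AffineZariskiSite.relativeGluingData (symSheafStr_coequifibered M)

/-- The `X`-scheme `L(M) = Spec_X (Sym M)`. -/
def symSpec (M : X.Modules) [IsLocalizingModule M] : Over X :=
  Over.mk (symGluing M).toBase

instance (M : X.Modules) [IsLocalizingModule M] : HasColimit (symGluing M).functor :=
  have : ((symGluing M).functor ⋙ Scheme.forget).IsLocallyDirected :=
    Scheme.Cover.RelativeGluingData.instIsLocallyDirectedI₀CompFunctorForgetOfIsThin ..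
  inferInstance

/-- The open immersion `Spec Sym Γ(M, U) ⟶ L(M)`, with image the preimage of the affine open `U`. -/
def symSpecChart (M : X.Modules) [IsLocalizingModule M] (U : X.AffineZariskiSite) :
    Spec (.of (SymmetricAlgebra Γ(X, U.toOpens) Γ(M, U.toOpens))) ⟶ (symSpec M).left :=
  colimit.ι (symGluing M).functor U

/-- A morphism of `𝒪_X`-modules on sections over `U`, as a linear map. -/
def modMap {M N : X.Modules} (φ : M ⟶ N) (U : X.Opens) : Γ(M, U) →ₗ[Γ(X, U)] Γ(N, U) where
  toFun x := φ.app U x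
  map_add' := map_add _
  map_smul' r x := φ.app_smul r x

/-- `Sym` of a morphism of modules. -/
def symSheafMap {M N : X.Modules} (φ : M ⟶ N) : symSheaf M ⟶ symSheaf N where
  app U := CommRingCat.ofHom (symMap (RingHom.id _) (modMap φ U.unop.toOpens))
  naturality U V i := by
    have hi := Scheme.AffineZariskiSite.toOpens_mono i.unop.le
    refine CommRingCat.hom_ext (symRingHom_ext (fun r => ?_) (fun m => ?_))
    · refine (congrArg (symMap _ _) (symMap_algebraMap _ (modRes M hi) r)).trans ?_
      refine Eq.trans ?_ (congrArg (symMap _ (modRes N hi)) (symMap_algebraMap _ _ r)).symm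
      exact (symMap_algebraMap _ _ _).trans (symMap_algebraMap _ (modRes N hi) _).symm
    · refine (congrArg (symMap _ _) (symMap_ι _ (modRes M hi) m)).trans ?_
      refine Eq.trans ?_ (congrArg (symMap _ (modRes N hi)) (symMap_ι _ _ m)).symm
      refine ((symMap_ι _ _ _).trans ?_).trans (symMap_ι _ (modRes N hi) _).symm
      exact congrArg (SymmetricAlgebra.ι _ _) (modules_app_map φ hi m)

lemma symSheafStr_map {M N : X.Modules} (φ : M ⟶ N) :
    symSheafStr M ≫ symSheafMap φ = symSheafStr N := by
  refine NatTrans.ext (funext fun U => CommRingCat.hom_ext (RingHom.ext fun r => ?_))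
  exact symMap_algebraMap (RingHom.id _) (modMap φ U.unop.toOpens) r

lemma symSheafMap_id (M : X.Modules) : symSheafMap (𝟙 M) = 𝟙 _ := by
  refine NatTrans.ext (funext fun U => CommRingCat.hom_ext
    (symRingHom_ext (fun r => ?_) (fun m => ?_)))
  · exact symMap_algebraMap (RingHom.id _) (modMap (𝟙 M) U.unop.toOpens) r
  · exact symMap_ι (RingHom.id _) (modMap (𝟙 M) U.unop.toOpens) m

lemma symSheafMap_comp {M N P : X.Modules} (φ : M ⟶ N) (ψ : N ⟶ P) :
    symSheafMap (φ ≫ ψ) = symSheafMap φ ≫ symSheafMap ψ := by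
  refine NatTrans.ext (funext fun U => CommRingCat.hom_ext
    (symRingHom_ext (fun r => ?_) (fun m => ?_)))
  · refine (symMap_algebraMap (RingHom.id _) (modMap (φ ≫ ψ) U.unop.toOpens) r).trans ?_
    refine Eq.trans ?_ (congrArg (symMap (RingHom.id _) (modMap ψ U.unop.toOpens))
      (symMap_algebraMap (RingHom.id _) (modMap φ U.unop.toOpens) r)).symm
    exact (symMap_algebraMap (RingHom.id _) (modMap ψ U.unop.toOpens) _).symm
  · refine (symMap_ι (RingHom.id _) (modMap (φ ≫ ψ) U.unop.toOpens) m).trans ?_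
    refine Eq.trans ?_ (congrArg (symMap (RingHom.id _) (modMap ψ U.unop.toOpens))
      (symMap_ι (RingHom.id _) (modMap φ U.unop.toOpens) m)).symm
    exact (symMap_ι (RingHom.id _) (modMap ψ U.unop.toOpens) _).symm

/-- The map of gluing data induced by a morphism of modules. -/
def symGluingMap {M N : X.Modules} [IsLocalizingModule M] [IsLocalizingModule N] (φ : M ⟶ N) :
    (symGluing N).functor ⟶ (symGluing M).functor :=
  Functor.whiskerRight (NatTrans.rightOp (symSheafMap φ)) Scheme.Spec

/-- The morphism `L(φ) : L(N) ⟶ L(M)` over `X` induced by `φ : M ⟶ N`. -/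
def symSpecMap {M N : X.Modules} [IsLocalizingModule M] [IsLocalizingModule N] (φ : M ⟶ N) :
    symSpec N ⟶ symSpec M :=
  Over.homMk (colimMap (symGluingMap φ)) (by
    refine colimit.hom_ext fun U => ?_
    change colimit.ι (symGluing N).functor U ≫ _ ≫ (symGluing M).toBase =
      colimit.ι (symGluing N).functor U ≫ (symGluing N).toBase
    rw [ι_colimMap_assoc, Scheme.Cover.RelativeGluingData.ι_toBase,
      Scheme.Cover.RelativeGluingData.ι_toBase]
    have := congr(Spec.map (($(symSheafStr_map φ)).app (op U)) ≫
      (Scheme.AffineZariskiSite.restrictIsoSpec X).inv.app U)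
    rw [NatTrans.comp_app, Spec.map_comp, Category.assoc] at this
    exact (Category.assoc _ _ _).symm.trans (congrArg (· ≫ U.1.ι) this))

lemma symSpecChart_map {M N : X.Modules} [IsLocalizingModule M] [IsLocalizingModule N]
    (φ : M ⟶ N) (U : X.AffineZariskiSite) :
    symSpecChart N U ≫ (symSpecMap φ).left =
      Spec.map ((symSheafMap φ).app (op U)) ≫ symSpecChart M U :=
  ι_colimMap (symGluingMap φ) U

lemma symSpecMap_id (M : X.Modules) [IsLocalizingModule M] :
    symSpecMap (𝟙 M) = 𝟙 (symSpec M) := by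
  refine Over.OverMorphism.ext (colimit.hom_ext fun U => ?_)
  refine (symSpecChart_map (𝟙 M) U).trans ?_
  rw [symSheafMap_id, NatTrans.id_app]
  erw [Spec.map_id]
  exact (Category.id_comp _).trans (Category.comp_id _).symm

lemma symSpecMap_comp {M N P : X.Modules} [IsLocalizingModule M] [IsLocalizingModule N]
    [IsLocalizingModule P] (φ : M ⟶ N) (ψ : N ⟶ P) :
    symSpecMap (φ ≫ ψ) = symSpecMap ψ ≫ symSpecMap φ := by
  refine Over.OverMorphism.ext (colimit.hom_ext fun U => ?_)
  refine (symSpecChart_map (φ ≫ ψ) U).trans ?_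
  rw [symSheafMap_comp, NatTrans.comp_app, Spec.map_comp]
  refine (Category.assoc _ _ _).trans ?_
  refine (congrArg (_ ≫ ·) (symSpecChart_map φ U).symm).trans ?_
  refine (Category.assoc _ _ _).symm.trans ?_
  exact (congrArg (· ≫ (symSpecMap φ).left) (symSpecChart_map ψ U).symm).trans
    (Category.assoc _ _ _)

/-! ### Linear spaces -/

/-- A (representable) linear space `L(𝓔) = Spec_X (Sym 𝓔)` over a locally noetherian scheme `X`,
given by its coherent sheaf `𝓔` of linear functions. -/
structure LinearSpace (X : Scheme.{u}) where
  /-- the sheaf of linear functions -/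
  sheaf : X.Modules
  quasicoherent : sheaf.IsQuasicoherent
  finiteType : SheafOfModules.IsFiniteType.{u} (R := X.ringCatSheaf) sheaf

attribute [instance] LinearSpace.quasicoherent

/-- A homomorphism of linear spaces `E ⟶ F`, given by the pull-back of linear functions
`𝓕 ⟶ 𝓔`. -/
@[ext]
structure LinearSpace.Hom (E F : LinearSpace X) where
  /-- the pull-back of linear functions -/
  dual : F.sheaf ⟶ E.sheaf

instance : Category (LinearSpace X) where
  Hom := LinearSpace.Hom
  id E := ⟨𝟙 E.sheaf⟩
  comp f g := ⟨g.dual ≫ f.dual⟩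
  id_comp f := LinearSpace.Hom.ext (Category.comp_id f.dual)
  comp_id f := LinearSpace.Hom.ext (Category.id_comp f.dual)
  assoc f g h := LinearSpace.Hom.ext (Category.assoc h.dual g.dual f.dual).symm

/-- The underlying `X`-scheme of a linear space. -/
def LinearSpace.toOver : LinearSpace X ⥤ Over X where
  obj E := symSpec E.sheaf
  map f := symSpecMap f.dual
  map_id E := symSpecMap_id E.sheaf
  map_comp f g := symSpecMap_comp g.dual f.dual

/-- A linear space is a vector bundle if its sheaf of linear functions is locally free. -/
def LinearSpace.IsVectorBundle (E : LinearSpace X) : Prop :=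
  SheafOfModules.IsLocallyFree (R := X.ringCatSheaf) E.sheaf

/-- The open immersion `Spec Sym Γ(𝓔, U) ⟶ L(𝓔)` for an affine open `U` of `X`. -/
def LinearSpace.chart (E : LinearSpace X) (U : X.AffineZariskiSite) :
    Spec (.of (SymmetricAlgebra Γ(X, U.toOpens) Γ(E.sheaf, U.toOpens))) ⟶
      (LinearSpace.toOver.obj E).left :=
  symSpecChart E.sheaf U

/-- Closed subschemes of (the total space of) a linear space, given by their quasi-coherent ideal
sheaves. The order on ideal sheaves is opposite to the inclusion of closed subschemes. -/
abbrev LinearSpace.ClosedSubscheme (E : LinearSpace X) : Type u :=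
  (LinearSpace.toOver.obj E).left.IdealSheafData

/-- The scheme `E ⊕ F = E ×_X F = L(𝓔 ⊕ 𝓕)`. -/
def LinearSpace.sum (E F : LinearSpace X) : Scheme.{u} := (symSpec (E.sheaf ⊞ F.sheaf)).left

/-- The projection `E ⊕ F ⟶ F`. -/
def LinearSpace.sumSnd (E F : LinearSpace X) : E.sum F ⟶ (LinearSpace.toOver.obj F).left :=
  (symSpecMap (biprod.inr : F.sheaf ⟶ E.sheaf ⊞ F.sheaf)).left

/-- For homomorphisms `f : E ⟶ G` and `g : F ⟶ G`, the homomorphism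
`f ∘ pr₁ + g ∘ pr₂ : E ⊕ F ⟶ G`; on linear functions it is `(f, g) : 𝓖 ⟶ 𝓔 ⊕ 𝓕`. -/
def LinearSpace.sumDesc {E F G : LinearSpace X} (f : E ⟶ G) (g : F ⟶ G) :
    E.sum F ⟶ (LinearSpace.toOver.obj G).left :=
  (symSpecMap (biprod.lift f.dual g.dual)).left

/-! ### Cones -/

/-- The ideal of a closed subscheme `C ⊆ L(𝓔)` in `Sym Γ(𝓔, U)`, for an affine open `U` of `X`. -/
def LinearSpace.ClosedSubscheme.idealOver {E : LinearSpace X} (C : E.ClosedSubscheme)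
    (U : X.AffineZariskiSite) : Ideal (SymmetricAlgebra Γ(X, U.toOpens) Γ(E.sheaf, U.toOpens)) :=
  ((Scheme.IdealSheafData.comap C (E.chart U)).ideal ⟨⊤, isAffineOpen_top _⟩).comap
    (Scheme.ΓSpecIso (.of (SymmetricAlgebra Γ(X, U.toOpens) Γ(E.sheaf, U.toOpens)))).inv.hom

/-- A closed subscheme `C ⊆ E = L(𝓔)` is a cone if it is of the form `Spec_X S` with `S` a graded
quotient algebra of `Sym 𝓔` such that `S⁰ = 𝒪_X`. In other words its ideal is homogeneous, i.e.
generated by elements of the graded pieces `Sym^d` (the `d`-th power of the module of linear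
functions), and contains no nonzero element of degree zero. -/
def LinearSpace.IsCone (E : LinearSpace X) (C : E.ClosedSubscheme) : Prop :=
  ∀ U : X.AffineZariskiSite,
    C.idealOver U = Ideal.span {a | a ∈ C.idealOver U ∧
      ∃ d : ℕ, a ∈ LinearMap.range (SymmetricAlgebra.ι Γ(X, U.toOpens) Γ(E.sheaf, U.toOpens)) ^ d} ∧
    ∀ r : Γ(X, U.toOpens), algebraMap _ _ r ∈ C.idealOver U → r = 0

/-- `C ⊆ F` is an `E`-cone, for a homomorphism `D : E ⟶ F` of linear spaces: it is a cone, and it is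
preserved by the additive action `α = D ∘ pr₁ + pr₂ : E ⊕ F ⟶ F` of `E` on `F`, i.e.
`E ⊕ C ⊆ α⁻¹(C)` as closed subschemes of `E ⊕ F`. -/
def LinearSpace.IsEquivariantCone {E F : LinearSpace X} (D : E ⟶ F) (C : F.ClosedSubscheme) :
    Prop :=
  F.IsCone C ∧
    Scheme.IdealSheafData.comap C (LinearSpace.sumDesc D (𝟙 F)) ≤
      Scheme.IdealSheafData.comap C (E.sumSnd F)

/-! ### Two-term complexes, going up and going down -/

/-- Two-term complexes `F₀ ⟶ F₁` of linear spaces; morphisms are commutative squares. For a complex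
`F`, one has `F₀ = F.left`, `F₁ = F.right`, and `F.hom` is the differential. -/
abbrev TwoTermComplex (X : Scheme.{u}) : Type (u + 1) := Arrow (LinearSpace X)

namespace TwoTermComplex

variable {F E : TwoTermComplex X}

lemma dual_w (Φ : F ⟶ E) :
    E.hom.dual ≫ Φ.left.dual = Φ.right.dual ≫ F.hom.dual :=
  congrArg LinearSpace.Hom.dual Φ.w

/-- A morphism of two-term complexes is a quasi-isomorphism if it induces isomorphisms on `H⁰` and
`H¹`. Here `H⁰` (the kernel of `F₀ ⟶ F₁`) and `H¹` (its cokernel) are the linear spaces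
corresponding to the cokernel and to the kernel of the dual map of coherent sheaves `𝓕₁ ⟶ 𝓕₀`. -/
def IsQuasiIso (Φ : F ⟶ E) : Prop :=
  IsIso (cokernel.map E.hom.dual F.hom.dual Φ.right.dual Φ.left.dual (dual_w Φ)) ∧
  IsIso (kernel.map E.hom.dual F.hom.dual Φ.right.dual Φ.left.dual (dual_w Φ))

/-- The `F₀`-cones in `F₁`. -/
def cones (F : TwoTermComplex X) : Set F.right.ClosedSubscheme :=
  {C | LinearSpace.IsEquivariantCone F.hom C}

/-- Going up (pull-back): the scheme-theoretic preimage `Φ₁⁻¹(C)`. -/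
def goUp (Φ : F ⟶ E) (C : E.right.ClosedSubscheme) : F.right.ClosedSubscheme :=
  Scheme.IdealSheafData.comap C (LinearSpace.toOver.map Φ.right).left

/-- The homomorphism `q = D ∘ pr₁ + Φ₁ ∘ pr₂ : E₀ ⊕ F₁ ⟶ E₁`, where `D` is the differential
of `E`. -/
def sumToTarget (Φ : F ⟶ E) : E.left.sum F.right ⟶ (LinearSpace.toOver.obj E.right).left :=
  LinearSpace.sumDesc E.hom Φ.right

/-- `D` is a push-forward of `C` along a quasi-isomorphism `Φ`: it is a cone in `E₁` such that
`q⁻¹(D) = E₀ ⊕ C`. (For a quasi-isomorphism, `q` is an epimorphism of linear spaces, so that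
requiring `D` to lie in the image of `q` would be no condition.) -/
def IsPushForward (Φ : F ⟶ E) (C : F.right.ClosedSubscheme) (D : E.right.ClosedSubscheme) : Prop :=
  E.right.IsCone D ∧
    Scheme.IdealSheafData.comap D (sumToTarget Φ) =
      Scheme.IdealSheafData.comap C (E.left.sumSnd F.right)

open Classical in
/-- Going down (push-forward): the cone `D` in `E₁` with `q⁻¹(D) = E₀ ⊕ C` (and the empty subscheme
if there is no such cone). -/
def goDown (Φ : F ⟶ E) (C : F.right.ClosedSubscheme) : E.right.ClosedSubscheme :=
  if h : ∃ D, IsPushForward Φ C D then h.choose else ⊤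

end TwoTermComplex

end AlgebraicGeometry

end

/-! Write $\mathcal N_i$, $\mathcal M_i$ for the sheaves of linear functions on $E_i$, $F_i$. A
quasi-isomorphism is a square of sheaves whose mapping cone $0\to\mathcal N_1\to\mathcal
N_0\oplus\mathcal M_1\to\mathcal M_0\to 0$ is exact (`epi_desc_of_isIso_cokernelMap`,
`mono_lift_of_isIso_kernelMap`, `exact_lift_desc`). As $\mathcal M_0$ is locally free, the sequence
splits on sections over small affine opens (`exists_split`). The first map is dual to $q$, so
locally $q$ is the projection $E_1\oplus F_0\to E_1$ of a trivial bundle.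

Uniqueness: extension of ideals along a split injection of linear functions loses nothing, so
$q^{-1}$ is injective on closed subschemes (`HasLocalRetractions.symPull_injective`).

Existence: the candidate is the contraction to $\operatorname{Sym}\mathcal N_1$ of the ideal of
$E_0\oplus C$. It is again the ideal of a cone. In a local splitting, invariance of $C$ under $F_0$
says exactly that $E_0\oplus C$ is constant along the fibres of $q$, hence is the preimage of
something (`map_le_map_comap_of_invariant`, globalised in `symPull_map_eq`).

The bijections are then formal. Factoring $q$ through the action of $E_0$ shows that an invariant
$\bar C$ is the push-forward of $\Phi_1^{-1}(\bar C)$; restricting $q$ to $0\oplus F_1$ recovers $C$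
from its push-forward; and invariance of a push-forward can be tested after pulling back along
$\mathrm{id}\times q$. Functoriality of going down follows from that of going up, its inverse. -/

noncomputable section

/-! ### Homogeneous ideals of symmetric algebras, and descent of invariant ideals. -/

section Algebra

variable {R M N P : Type*} [CommRing R] [AddCommGroup M] [AddCommGroup N] [AddCommGroup P]
  [Module R M] [Module R N] [Module R P]

/-- The ring homomorphism on symmetric algebras induced by a linear map. -/
abbrev symLin (g : M →ₗ[R] N) : SymmetricAlgebra R M →+* SymmetricAlgebra R N :=
  symMap (RingHom.id R) g

lemma symLin_comp (h : N →ₗ[R] P) (g : M →ₗ[R] N) :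
    (symLin h).comp (symLin g) = symLin (h ∘ₗ g) :=
  symRingHom_ext (by simp) (by simp)

lemma symLin_id : symLin (LinearMap.id : M →ₗ[R] M) = RingHom.id _ :=
  symRingHom_ext (by simp) (by simp)

lemma map_symLin_map (h : N →ₗ[R] P) (g : M →ₗ[R] N) (I : Ideal (SymmetricAlgebra R M)) :
    (I.map (symLin g)).map (symLin h) = I.map (symLin (h ∘ₗ g)) := by
  rw [Ideal.map_map, symLin_comp]

namespace SymmetricAlgebra

variable (R M) in
/-- The coaction of the multiplicative group on `Sym M` that defines the grading. -/
def gradingHom : SymmetricAlgebra R M →ₐ[R] Polynomial (SymmetricAlgebra R M) :=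
  SymmetricAlgebra.lift
    ((LinearMap.mulLeft R (Polynomial.X : Polynomial (SymmetricAlgebra R M))) ∘ₗ
      (Algebra.linearMap (SymmetricAlgebra R M) (Polynomial (SymmetricAlgebra R M))).restrictScalars
        R ∘ₗ SymmetricAlgebra.ι R M)

@[simp] lemma gradingHom_ι (m : M) :
    gradingHom R M (ι R M m) = Polynomial.X * Polynomial.C (ι R M m) :=
  SymmetricAlgebra.lift_ι_apply _ _

@[simp] lemma gradingHom_algebraMap (r : R) :
    gradingHom R M (algebraMap R _ r) = Polynomial.C (algebraMap R _ r) :=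
  (gradingHom R M).commutes r

lemma gradingHom_of_mem_pow {d : ℕ} {a : SymmetricAlgebra R M}
    (ha : a ∈ LinearMap.range (ι R M) ^ d) :
    gradingHom R M a = Polynomial.C a * Polynomial.X ^ d := by
  induction ha using Submodule.pow_induction_on_left' with
  | algebraMap r => simp
  | add x y i hx hy hx' hy' => rw [map_add, hx', hy', map_add, add_mul]
  | mem_mul m hm i x hx hx' =>
    obtain ⟨m, rfl⟩ := hm
    rw [map_mul, hx', gradingHom_ι, map_mul, Nat.succ_eq_add_one]
    ring

/-- With `gradingHom_of_mem_pow` and `eval_one_gradingHom`, this makes the coefficient of $X^d$ the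
degree $d$ component of `x`, so no direct sum decomposition of the symmetric algebra is needed. -/
lemma coeff_gradingHom_mem (x : SymmetricAlgebra R M) (d : ℕ) :
    (gradingHom R M x).coeff d ∈ LinearMap.range (ι R M) ^ d := by
  induction x using SymmetricAlgebra.induction generalizing d with
  | algebraMap r =>
    rw [gradingHom_algebraMap, Polynomial.coeff_C]
    split_ifs with h
    · subst h
      rw [pow_zero]
      exact Submodule.algebraMap_mem r
    · exact zero_mem _
  | ι m =>
    rw [gradingHom_ι, mul_comm, Polynomial.coeff_C_mul_X]
    split_ifs with h
    · subst h
      rw [pow_one]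
      exact ⟨m, rfl⟩
    · exact zero_mem _
  | mul a b ha hb =>
    rw [map_mul, Polynomial.coeff_mul]
    refine sum_mem fun p hp => ?_
    rw [← Finset.HasAntidiagonal.mem_antidiagonal.mp hp, pow_add]
    exact Submodule.mul_mem_mul (ha _) (hb _)
  | add a b ha hb =>
    rw [map_add, Polynomial.coeff_add]
    exact add_mem (ha d) (hb d)

lemma eval_one_gradingHom (x : SymmetricAlgebra R M) : (gradingHom R M x).eval 1 = x := by
  have : (Polynomial.evalRingHom 1).comp (gradingHom R M).toRingHom = RingHom.id _ :=
    symRingHom_ext (by simp) (by simp)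
  exact congr($this x)

lemma gradingHom_symLin (g : M →ₗ[R] N) (x : SymmetricAlgebra R M) :
    gradingHom R N (symLin g x) = (gradingHom R M x).map (symLin g) := by
  have : (gradingHom R N).toRingHom.comp (symLin g) =
      (Polynomial.mapRingHom (symLin g)).comp (gradingHom R M).toRingHom :=
    symRingHom_ext (by simp) (by simp)
  exact congr($this x)

lemma coeff_zero_gradingHom (x : SymmetricAlgebra R M) :
    (gradingHom R M x).coeff 0 = algebraMap R _ (algebraMapInv x) := by
  have : (Polynomial.constantCoeff).comp (gradingHom R M).toRingHom =
      (algebraMap R (SymmetricAlgebra R M)).comp (algebraMapInv (R := R) (M := M)).toRingHom :=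
    symRingHom_ext (by simp) (by simp [algebraMapInv_ι (R := R)])
  exact congr($this x)

lemma algebraMapInv_symLin (g : M →ₗ[R] N) (x : SymmetricAlgebra R M) :
    algebraMapInv (symLin g x) = algebraMapInv x := by
  have : (algebraMapInv (R := R) (M := N)).toRingHom.comp (symLin g) =
      (algebraMapInv (R := R) (M := M)).toRingHom :=
    symRingHom_ext (by simp) (by simp [algebraMapInv_ι (R := R)])
  exact congr($this x)

/-- The ideal of a cone: a homogeneous ideal of `Sym M` without nonzero elements of degree zero. -/
def IsConeIdeal (I : Ideal (SymmetricAlgebra R M)) : Prop :=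
  I = Ideal.span {a | a ∈ I ∧ ∃ d : ℕ, a ∈ LinearMap.range (ι R M) ^ d} ∧
    ∀ r : R, algebraMap R _ r ∈ I → r = 0

/-- Homogeneity becomes stability under taking components, and $S^0=\mathcal O_X$ becomes
containment in the augmentation ideal. Both `gradingHom` and `algebraMapInv` commute with `symLin`,
so in this form the conditions pass to extensions and contractions. -/
lemma isConeIdeal_iff (I : Ideal (SymmetricAlgebra R M)) :
    IsConeIdeal I ↔ (∀ x ∈ I, ∀ d, (gradingHom R M x).coeff d ∈ I) ∧
      ∀ x ∈ I, algebraMapInv x = (0 : R) := by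
  have key : I = Ideal.span {a | a ∈ I ∧ ∃ d : ℕ, a ∈ LinearMap.range (ι R M) ^ d} ↔
      ∀ x ∈ I, ∀ d, (gradingHom R M x).coeff d ∈ I := by
    refine ⟨fun h x hx => ?_, fun h => le_antisymm (fun x hx => ?_) ?_⟩
    · rw [h] at hx
      induction hx using Submodule.span_induction with
      | mem a ha =>
        obtain ⟨ha, e, he⟩ := ha
        intro d
        rw [gradingHom_of_mem_pow he, Polynomial.coeff_C_mul_X_pow]
        split_ifs
        exacts [ha, zero_mem _]
      | zero => simp
      | add a b _ _ ha hb =>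
        intro d
        rw [map_add, Polynomial.coeff_add]
        exact add_mem (ha d) (hb d)
      | smul b a _ ha =>
        intro d
        rw [smul_eq_mul, map_mul, Polynomial.coeff_mul]
        exact sum_mem fun p _ => I.mul_mem_left _ (ha _)
    · rw [← eval_one_gradingHom x, Polynomial.eval_eq_sum_range]
      refine sum_mem fun d _ => ?_
      rw [one_pow, mul_one]
      exact Ideal.subset_span ⟨h x hx d, d, coeff_gradingHom_mem x d⟩
    · rw [Ideal.span_le]
      exact fun a ha => ha.1
  refine (and_congr_left fun _ => key).trans (and_congr_right fun h => ?_)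
  refine ⟨fun h0 x hx => h0 _ ?_, fun h0 r hr => ?_⟩
  · rw [← coeff_zero_gradingHom]
    exact h x hx 0
  · rw [← algebraMap_leftInverse (M := M) r]
    exact h0 _ hr

lemma IsConeIdeal.map {I : Ideal (SymmetricAlgebra R M)} (hI : IsConeIdeal I) (g : M →ₗ[R] N) :
    IsConeIdeal (I.map (symLin g)) := by
  rw [isConeIdeal_iff] at hI ⊢
  refine ⟨fun x hx => ?_, fun x hx => ?_⟩
  · induction hx using Submodule.span_induction with
    | mem a ha =>
      obtain ⟨a, ha, rfl⟩ := ha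
      intro d
      rw [gradingHom_symLin, Polynomial.coeff_map]
      exact Ideal.mem_map_of_mem _ (hI.1 a ha d)
    | zero => simp
    | add a b _ _ ha hb =>
      intro d
      rw [map_add, Polynomial.coeff_add]
      exact add_mem (ha d) (hb d)
    | smul b a _ ha =>
      intro d
      rw [smul_eq_mul, map_mul, Polynomial.coeff_mul]
      exact sum_mem fun p _ => Ideal.mul_mem_left _ _ (ha _)
  · have : I.map (symLin g) ≤ RingHom.ker (algebraMapInv (R := R) (M := N)) := by
      rw [Ideal.map_le_iff_le_comap]
      intro a ha
      rw [Ideal.mem_comap, RingHom.mem_ker, algebraMapInv_symLin]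
      exact hI.2 a ha
    exact this hx

lemma IsConeIdeal.comap {I : Ideal (SymmetricAlgebra R N)} (hI : IsConeIdeal I) (g : M →ₗ[R] N) :
    IsConeIdeal (I.comap (symLin g)) := by
  rw [isConeIdeal_iff] at hI ⊢
  refine ⟨fun x hx d => ?_, fun x hx => ?_⟩
  · rw [Ideal.mem_comap, ← Polynomial.coeff_map, ← gradingHom_symLin]
    exact hI.1 _ hx d
  · rw [← algebraMapInv_symLin g]
    exact hI.2 _ hx

end SymmetricAlgebra

/-- Let `N₁ ⟶ B ⟶ M₀` be a split exact sequence, and `I` an ideal of `Sym M₁` that is invariant under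
the coaction of `Sym M₀`. Then the extension of `I` to `Sym B` is the extension of an ideal of
`Sym N₁`. -/
lemma map_le_map_comap_of_invariant {M₀ M₁ N₁ B B' : Type*} [AddCommGroup M₀] [AddCommGroup M₁]
    [AddCommGroup N₁] [AddCommGroup B] [AddCommGroup B'] [Module R M₀] [Module R M₁] [Module R N₁]
    [Module R B] [Module R B'] (i : N₁ →ₗ[R] B) (p : B →ₗ[R] M₀) (s : M₀ →ₗ[R] B) (r : B →ₗ[R] N₁)
    (hr : i ∘ₗ r = LinearMap.id - s ∘ₗ p) (j : M₁ →ₗ[R] B) (δ : M₁ →ₗ[R] M₀) (hj : p ∘ₗ j = -δ)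
    (inl : M₀ →ₗ[R] B') (inr : M₁ →ₗ[R] B') (fst : B' →ₗ[R] M₀) (snd : B' →ₗ[R] M₁)
    (h₁ : fst ∘ₗ inl = LinearMap.id) (h₂ : snd ∘ₗ inl = 0) (h₃ : fst ∘ₗ inr = 0)
    (h₄ : snd ∘ₗ inr = LinearMap.id) (I : Ideal (SymmetricAlgebra R M₁))
    (hI : I.map (symLin (inl ∘ₗ δ + inr)) ≤ I.map (symLin inr)) :
    I.map (symLin j) ≤ ((I.map (symLin j)).comap (symLin i)).map (symLin i) := by
  have e₁ (x) : fst (inl x) = x := LinearMap.congr_fun h₁ x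
  have e₂ (x) : snd (inl x) = 0 := LinearMap.congr_fun h₂ x
  have e₃ (x) : fst (inr x) = 0 := LinearMap.congr_fun h₃ x
  have e₄ (x) : snd (inr x) = x := LinearMap.congr_fun h₄ x
  have e₅ (x) : p (j x) = - δ x := LinearMap.congr_fun hj x
  have e₆ (x) : i (r x) = x - s (p x) := LinearMap.congr_fun hr x
  -- Since $pj=-\delta$, one has $irj=j+s\delta$. Substituting
  -- $s\circ\mathrm{fst}+j\circ\mathrm{snd}$ into the invariance `hI` sends
  -- $\mathrm{inl}\,\delta+\mathrm{inr}$ to $irj$ and $\mathrm{inr}$ to $j$.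
  have key : I.map (symLin (i ∘ₗ r ∘ₗ j)) ≤ I.map (symLin j) := by
    have h := Ideal.map_mono (f := symLin (s ∘ₗ fst + j ∘ₗ snd)) hI
    rw [map_symLin_map, map_symLin_map] at h
    convert h using 3 <;> ext x <;> simp [e₁, e₂, e₃, e₄, e₅, e₆, add_comm]
  -- With the sign of $s$ reversed and $irj$ in place of $j$, the same substitution sends
  -- $\mathrm{inl}\,\delta+\mathrm{inr}$ to $j$ and $\mathrm{inr}$ to $irj$: translation by the
  -- inverse group element.
  have key' : I.map (symLin j) ≤ I.map (symLin (i ∘ₗ r ∘ₗ j)) := by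
    have h := Ideal.map_mono (f := symLin (-(s ∘ₗ fst) + (i ∘ₗ r ∘ₗ j) ∘ₗ snd)) hI
    rw [map_symLin_map, map_symLin_map] at h
    convert h using 3 <;> ext x <;> simp [e₁, e₂, e₃, e₄, e₅, e₆]
  -- The extension of `I` along $j$ thus equals its extension along $irj$, which visibly comes from
  -- the symmetric algebra of `N₁`.
  refine key'.trans ?_
  rw [← map_symLin_map]
  refine Ideal.map_mono (Ideal.map_le_iff_le_comap.mp ?_)
  rw [map_symLin_map]
  exact key

end Algebra

/-! ### Ideal sheaves on $\operatorname{Spec}_X(\operatorname{Sym}\mathcal M)$, computed on the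
affine charts. -/

namespace AlgebraicGeometry
open Opposite

section Affine

variable {A B : CommRingCat.{u}}

/-- The ideal of the ring of global functions given by an ideal sheaf on an affine scheme. -/
def specIdeal (I : (Spec A).IdealSheafData) : Ideal A :=
  (I.ideal ⟨⊤, isAffineOpen_top _⟩).comap (Scheme.ΓSpecIso A).inv.hom

lemma specIdeal_le_iff {I J : (Spec A).IdealSheafData} : specIdeal I ≤ specIdeal J ↔ I ≤ J := by
  refine ⟨fun h => Scheme.IdealSheafData.le_of_isAffine ?_, fun h => Ideal.comap_mono (h _)⟩
  exact (Ideal.comap_le_comap_iff_of_surjective _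
    (ConcreteCategory.bijective_of_isIso (Scheme.ΓSpecIso A).inv).2 _ _).mp h

lemma specIdeal_surjective (K : Ideal A) : ∃ I : (Spec A).IdealSheafData, specIdeal I = K := by
  refine ⟨Scheme.IdealSheafData.equivOfIsAffine.symm (K.comap (Scheme.ΓSpecIso A).hom.hom), ?_⟩
  have : (Scheme.IdealSheafData.equivOfIsAffine.symm
      (K.comap (Scheme.ΓSpecIso A).hom.hom)).ideal ⟨⊤, isAffineOpen_top _⟩ =
      K.comap (Scheme.ΓSpecIso A).hom.hom :=
    Scheme.IdealSheafData.equivOfIsAffine.apply_symm_apply _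
  rw [specIdeal, this, Ideal.comap_comap, ← CommRingCat.hom_comp, Iso.inv_hom_id]
  exact Ideal.comap_id K

lemma specIdeal_map (J : (Spec B).IdealSheafData) (f : A ⟶ B) :
    specIdeal (J.map (Spec.map f)) = (specIdeal J).comap f.hom := by
  rw [specIdeal, Scheme.IdealSheafData.ideal_map_of_isAffineHom, specIdeal, Ideal.comap_comap,
    Ideal.comap_comap, ← CommRingCat.hom_comp, ← CommRingCat.hom_comp]
  congr 2
  exact (Scheme.ΓSpecIso_inv_naturality f).symm

/-- Pull-back of ideal sheaves is left adjoint to push-forward, and extension of ideals to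
contraction; the right adjoints agree by `specIdeal_map`, hence so do the left ones. -/
lemma specIdeal_comap (I : (Spec A).IdealSheafData) (f : A ⟶ B) :
    specIdeal (I.comap (Spec.map f)) = (specIdeal I).map f.hom := by
  refine eq_of_forall_ge_iff fun K => ?_
  obtain ⟨J, rfl⟩ := specIdeal_surjective K
  rw [specIdeal_le_iff, ← Scheme.IdealSheafData.le_map_iff_comap_le, ← specIdeal_le_iff,
    specIdeal_map, Ideal.map_le_iff_le_comap]

end Affine

variable {X : Scheme.{u}} {M N : X.Modules} [IsLocalizingModule M] [IsLocalizingModule N]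

instance isOpenImmersion_symSpecChart (U : X.AffineZariskiSite) :
    IsOpenImmersion (symSpecChart M U) :=
  have : ((symGluing M).functor ⋙ Scheme.forget).IsLocallyDirected :=
    Scheme.Cover.RelativeGluingData.instIsLocallyDirectedI₀CompFunctorForgetOfIsThin ..
  inferInstanceAs (IsOpenImmersion (colimit.ι (symGluing M).functor U))

lemma opensRange_symSpecChart (U : X.AffineZariskiSite) :
    (symSpecChart M U).opensRange = (symSpec M).hom ⁻¹ᵁ U.toOpens := by
  have := (symGluing M).toBase_preimage_eq_opensRange_ι U
  refine this.symm.trans ?_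
  congr 1
  exact Scheme.Opens.opensRange_ι U.1

instance : IsAffineHom (symSpec M).hom := by
  refine isAffineHom_of_forall_exists_isAffineOpen _ fun x => ?_
  obtain ⟨U, hU⟩ := TopologicalSpace.Opens.mem_iSup.mp
    ((iSup_affineOpens_eq_top X).ge (Set.mem_univ x))
  refine ⟨U.1, hU, U.2, ?_⟩
  have := opensRange_symSpecChart (M := M) U
  change IsAffineOpen ((symSpec M).hom ⁻¹ᵁ Scheme.AffineZariskiSite.toOpens U)
  rw [← this]
  have := isOpenImmersion_symSpecChart (M := M) U
  exact isAffineOpen_opensRange (symSpecChart M U)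

instance (φ : M ⟶ N) : IsAffineHom (symSpecMap φ).left := by
  have : IsAffineHom ((symSpecMap φ).left ≫ (symSpec M).hom) := by
    rw [Over.w]; infer_instance
  exact MorphismProperty.of_postcomp @IsAffineHom (W' := @IsSeparated) (symSpecMap φ).left
    (symSpec M).hom inferInstance this

lemma ideal_eq_comap_of_eq {Y : Scheme.{u}} (J : Y.IdealSheafData) {V W : Y.affineOpens}
    (h : V.1 = W.1) : J.ideal V = (J.ideal W).comap (Y.presheaf.map (eqToHom h.symm).op).hom := by
  obtain rfl : V = W := Subtype.ext h
  simp

lemma appIso_inv_comp_app {Y Z Y' Z' : Scheme.{u}} (f : Y ⟶ Z) (f' : Y' ⟶ Z')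
    (i : Y' ⟶ Y) (j : Z' ⟶ Z) [IsOpenImmersion i] [IsOpenImmersion j] (w : i ≫ f = f' ≫ j)
    (U : Z'.Opens) (h : f ⁻¹ᵁ (j ''ᵁ U) = i ''ᵁ (f' ⁻¹ᵁ U)) :
    ((j.appIso U).inv ≫ f.app (j ''ᵁ U)) ≫ Y.presheaf.map (eqToHom h.symm).op =
      f'.app U ≫ (i.appIso (f' ⁻¹ᵁ U)).inv := by
  rw [Category.assoc, Iso.inv_comp_eq, ← Category.assoc, Iso.eq_comp_inv]
  simp [Scheme.Hom.appIso_hom', Scheme.Hom.app_eq_appLE, Scheme.Hom.appLE_comp_appLE, w,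
    -Scheme.Hom.comp_appLE]

/-- Push-forward of ideal sheaves along affine morphisms commutes with restriction to opens. -/
lemma comap_map_of_isOpenImmersion {Y Z Y' Z' : Scheme.{u}} (f : Y ⟶ Z) (f' : Y' ⟶ Z')
    (i : Y' ⟶ Y) (j : Z' ⟶ Z) [IsOpenImmersion i] [IsOpenImmersion j] [IsAffineHom f]
    [IsAffineHom f'] (w : i ≫ f = f' ≫ j) (hr : i.opensRange = f ⁻¹ᵁ j.opensRange)
    (J : Y.IdealSheafData) : (J.map f).comap j = (J.comap i).map f' := by
  refine Scheme.IdealSheafData.ext (funext fun U => ?_)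
  rw [Scheme.IdealSheafData.ideal_comap_of_isOpenImmersion,
    Scheme.IdealSheafData.ideal_map_of_isAffineHom,
    Scheme.IdealSheafData.ideal_map_of_isAffineHom,
    Scheme.IdealSheafData.ideal_comap_of_isOpenImmersion]
  -- By `hr`, the image of `i` is the whole preimage of the image of `j`, so no part of the preimage
  -- is missed.
  have h : f ⁻¹ᵁ (j ''ᵁ U) = i ''ᵁ (f' ⁻¹ᵁ U) := by
    have h1 : i ⁻¹ᵁ (f ⁻¹ᵁ (j ''ᵁ U)) = f' ⁻¹ᵁ U := by
      rw [← Scheme.Hom.comp_preimage, w, Scheme.Hom.comp_preimage, Scheme.Hom.preimage_image_eq]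
    rw [← h1, Scheme.Hom.image_preimage_eq_opensRange_inf, hr, ← Scheme.Hom.preimage_inf]
    congr 1
    exact (inf_eq_right.mpr (j.image_le_opensRange _)).symm
  refine (congrArg (fun I => Ideal.comap _ (Ideal.comap _ I)) (ideal_eq_comap_of_eq J
    (W := ⟨i ''ᵁ (f' ⁻¹ᵁ U.1), (U.2.preimage f').image_of_isOpenImmersion i⟩) h)).trans ?_
  rw [Ideal.comap_comap, Ideal.comap_comap, Ideal.comap_comap, ← CommRingCat.hom_comp,
    ← CommRingCat.hom_comp, ← CommRingCat.hom_comp]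
  congr 2
  exact appIso_inv_comp_app f f' i j w U.1 h

/-- The ideal of a closed subscheme of `Spec_X (Sym M)` over an affine open of `X`. -/
def symIdeal (C : (symSpec M).left.IdealSheafData) (U : X.AffineZariskiSite) :
    Ideal (SymmetricAlgebra Γ(X, U.toOpens) Γ(M, U.toOpens)) :=
  specIdeal (C.comap (symSpecChart M U))

lemma symIdeal_comap (φ : M ⟶ N) (C : (symSpec M).left.IdealSheafData) (U : X.AffineZariskiSite) :
    symIdeal (C.comap (symSpecMap φ).left) U = (symIdeal C U).map (symLin (modMap φ U.toOpens)) := by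
  rw [symIdeal, ← Scheme.IdealSheafData.comap_comp]
  refine (congrArg (fun f => specIdeal (C.comap f)) (symSpecChart_map φ U)).trans ?_
  refine (congrArg specIdeal (Scheme.IdealSheafData.comap_comp C _ _)).trans ?_
  exact specIdeal_comap _ _

/-- Push-forward of ideal sheaves can be computed chart by chart because the chart over `U` is the
full preimage of `U` in both total spaces. -/
lemma symIdeal_map (φ : M ⟶ N) (J : (symSpec N).left.IdealSheafData) (U : X.AffineZariskiSite) :
    symIdeal (J.map (symSpecMap φ).left) U =
      (symIdeal J U).comap (symLin (modMap φ U.toOpens)) := by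
  refine (congrArg specIdeal (comap_map_of_isOpenImmersion (symSpecMap φ).left
    (Spec.map (CommRingCat.ofHom (symLin (modMap φ U.toOpens)))) (symSpecChart N U)
    (symSpecChart M U) (symSpecChart_map φ U) ?_ J)).trans (specIdeal_map _ _)
  rw [opensRange_symSpecChart]
  refine Eq.trans ?_ (congrArg _ (opensRange_symSpecChart (M := M) U).symm)
  rw [← Scheme.Hom.comp_preimage, Over.w]

lemma le_of_symIdeal_le {ι : Type*} (U : ι → X.AffineZariskiSite) (hU : ⨆ i, (U i).toOpens = ⊤)
    {C C' : (symSpec M).left.IdealSheafData} (h : ∀ i, symIdeal C (U i) ≤ symIdeal C' (U i)) :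
    C ≤ C' := by
  refine Scheme.IdealSheafData.le_of_iSup_eq_top
    (fun i => ⟨symSpecChart M (U i) ''ᵁ ⊤, (isAffineOpen_top _).image_of_isOpenImmersion _⟩)
    ?_ fun i => ?_
  · simp only [Scheme.Hom.image_top_eq_opensRange, opensRange_symSpecChart]
    rw [← Scheme.Hom.preimage_iSup, hU]
    rfl
  · have := specIdeal_le_iff.mp (h i) ⟨⊤, isAffineOpen_top _⟩
    rw [Scheme.IdealSheafData.ideal_comap_of_isOpenImmersion,
      Scheme.IdealSheafData.ideal_comap_of_isOpenImmersion] at this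
    exact (Ideal.comap_le_comap_iff_of_surjective _
      (ConcreteCategory.bijective_of_isIso ((symSpecChart M (U i)).appIso ⊤).inv).2 _ _).mp this

end AlgebraicGeometry

/-! ### The mapping cone of a quasi-isomorphism in an abelian category. -/

section Abelian

variable {C : Type*} [Category C] [Abelian C] {N₁ N₀ M₁ M₀ : C} {d : N₁ ⟶ N₀} {d' : M₁ ⟶ M₀}
  {f₁ : N₁ ⟶ M₁} {f₀ : N₀ ⟶ M₀} (w : d ≫ f₀ = f₁ ≫ d')

include w in
-- A map killing $f_0$ and $d'$ factors through $\operatorname{coker} d'$ and vanishes on the image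
-- of $\operatorname{coker} d$, which is everything. Only surjectivity on cokernels matters; dually,
-- the next lemma needs only injectivity on kernels.
lemma epi_desc_of_isIso_cokernelMap [IsIso (cokernel.map d d' f₁ f₀ w)] :
    Epi (biprod.desc f₀ (-d')) := by
  rw [Preadditive.epi_iff_cancel_zero]
  intro P g hg
  have h₀ : f₀ ≫ g = 0 := by
    have := biprod.inl ≫= hg
    rwa [biprod.inl_desc_assoc, comp_zero] at this
  have h₁ : d' ≫ g = 0 := by
    have := biprod.inr ≫= hg
    rwa [biprod.inr_desc_assoc, comp_zero, Preadditive.neg_comp, neg_eq_zero] at this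
  have h : cokernel.map d d' f₁ f₀ w ≫ cokernel.desc d' g h₁ = 0 := by
    rw [← cancel_epi (cokernel.π d)]
    simp [h₀]
  have h' : cokernel.desc d' g h₁ = 0 := by
    rw [← cancel_epi (cokernel.map d d' f₁ f₀ w), h, comp_zero]
  rw [← cokernel.π_desc d' g h₁, h', comp_zero]

include w in
lemma mono_lift_of_isIso_kernelMap [IsIso (kernel.map d d' f₁ f₀ w)] :
    Mono (biprod.lift d f₁) := by
  rw [Preadditive.mono_iff_cancel_zero]
  intro P g hg
  have h₀ : g ≫ d = 0 := by
    have := hg =≫ biprod.fst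
    rwa [Category.assoc, biprod.lift_fst, zero_comp] at this
  have h₁ : g ≫ f₁ = 0 := by
    have := hg =≫ biprod.snd
    rwa [Category.assoc, biprod.lift_snd, zero_comp] at this
  have h : kernel.lift d g h₀ ≫ kernel.map d d' f₁ f₀ w = 0 := by
    rw [← cancel_mono (kernel.ι d')]
    simp [h₁]
  have h' : kernel.lift d g h₀ = 0 := by
    rw [← cancel_mono (kernel.map d d' f₁ f₀ w), h, zero_comp]
  rw [← kernel.lift_ι d g h₀, h', zero_comp]

/-- A morphism of two-term complexes that is a quasi-isomorphism has an exact mapping cone. -/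
lemma exact_lift_desc [IsIso (cokernel.map d d' f₁ f₀ w)] [IsIso (kernel.map d d' f₁ f₀ w)] :
    (ShortComplex.mk (biprod.lift d f₁) (biprod.desc f₀ (-d')) (by simp [w])).Exact := by
  rw [ShortComplex.exact_iff_exact_up_to_refinements]
  intro A x hx
  dsimp at x hx
  have hx' : (x ≫ biprod.fst) ≫ f₀ = (x ≫ biprod.snd) ≫ d' := by
    have e : x ≫ biprod.desc f₀ (-d') = (x ≫ biprod.fst) ≫ f₀ - (x ≫ biprod.snd) ≫ d' := by
      simp [biprod.desc_eq, sub_eq_add_neg]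
    exact sub_eq_zero.mp (e.symm.trans hx)
  -- For $x=(a,b)$ with $f_0a=d'b$, the class of $a$ dies in $\operatorname{coker} d'$, hence
  -- already in $\operatorname{coker} d$; so $a=dn$ after passing to a cover.
  have h : (x ≫ biprod.fst) ≫ cokernel.π d = 0 := by
    rw [← cancel_mono (cokernel.map d d' f₁ f₀ w), Category.assoc, cokernel.π_desc,
      ← Category.assoc, hx']
    simp
  obtain ⟨A', π, hπ, n, hn⟩ := (ShortComplex.exact_iff_exact_up_to_refinements _).mp
    (ShortComplex.exact_cokernel d) (x ≫ biprod.fst) h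
  dsimp at n hn
  have hk : (π ≫ x ≫ biprod.snd - n ≫ f₁) ≫ d' = 0 := by
    rw [Preadditive.sub_comp, Category.assoc, ← hx', Category.assoc, Category.assoc,
      ← w, ← reassoc_of% hn]
    simp
  -- The error $b-f_1n$ lies in $\ker d'\cong\ker d$. Adding its preimage to $n$ corrects the second
  -- coordinate and leaves $dn$ unchanged.
  refine ⟨A', π, hπ, n + kernel.lift d' _ hk ≫ inv (kernel.map d d' f₁ f₀ w) ≫ kernel.ι d, ?_⟩
  have h₁ : inv (kernel.map d d' f₁ f₀ w) ≫ kernel.ι d ≫ f₁ = kernel.ι d' := by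
    rw [IsIso.inv_comp_eq, kernel.lift_ι]
  dsimp
  ext
  · simp [hn]
  · simp [h₁]

end Abelian

/-! ### Sections over affine opens, and local splittings of the mapping cone. -/

namespace AlgebraicGeometry
open Opposite

section Spec

variable {R : CommRingCat.{u}}

/-- Global sections of quasi-coherent modules on an affine scheme preserve epimorphisms. -/
lemma epi_moduleSpecΓFunctor_map {M N : (Spec R).Modules} (p : M ⟶ N) [Epi p]
    [IsIso M.fromTildeΓ] [IsIso N.fromTildeΓ] : Epi ((moduleSpecΓFunctor (R := R)).map p) := by
  -- The tilde functor reflects epimorphisms, and by naturality of `fromTildeΓ` it carries the map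
  -- on global sections to `p` up to isomorphisms.
  apply (tilde.functor R).epi_of_epi_map
  have h := Scheme.Modules.fromTildeΓNatTrans.naturality p
  have : IsIso (Scheme.Modules.fromTildeΓNatTrans.app M) := ‹IsIso M.fromTildeΓ›
  have : IsIso (Scheme.Modules.fromTildeΓNatTrans.app N) := ‹IsIso N.fromTildeΓ›
  have h' := (IsIso.eq_comp_inv _).mpr h
  change (tilde.functor R).map ((moduleSpecΓFunctor (R := R)).map p) = _ at h'
  rw [h']
  dsimp
  infer_instance

/-- The condition means lying in the essential image of the tilde functor, which as a left adjoint
preserves biproducts. -/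
lemma isIso_fromTildeΓ_biprod (M N : (Spec R).Modules) [IsIso M.fromTildeΓ] [IsIso N.fromTildeΓ] :
    IsIso (M ⊞ N).fromTildeΓ := by
  have : PreservesColimitsOfSize.{0, 0} (tilde.functor R) :=
    (tilde.adjunction (R := R)).leftAdjoint_preservesColimits
  have : PreservesBinaryBiproducts (tilde.functor R) :=
    preservesBinaryBiproducts_of_preservesBinaryCoproducts _
  rw [isIso_fromTildeΓ_iff] at *
  obtain ⟨A, ⟨a⟩⟩ := ‹(tilde.functor R).essImage M›
  obtain ⟨B, ⟨b⟩⟩ := ‹(tilde.functor R).essImage N›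
  exact ⟨A ⊞ B, ⟨(tilde.functor R).mapBiprod A B ≪≫ biprod.mapIso a b⟩⟩

lemma projective_moduleSpecΓFunctor_obj {M : (Spec R).Modules} {I : Type u}
    (e : SheafOfModules.free I ≅ M) : Projective ((moduleSpecΓFunctor (R := R)).obj M) := by
  have e' := tilde.toTildeΓNatIso.app (ModuleCat.of R (I →₀ R)) ≪≫
    (moduleSpecΓFunctor (R := R)).mapIso (tildeFinsupp I ≪≫ e)
  have : Projective (ModuleCat.of R (I →₀ R)) :=
    (IsProjective.iff_projective _).mp inferInstance
  exact Projective.of_iso e' this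

end Spec

variable {X : Scheme.{u}}

lemma smul_restrict_fromSpec {U : X.Opens} (hU : IsAffineOpen U) (M : X.Modules)
    (V : (Spec Γ(X, U)).Opens) (hV : hU.fromSpec ''ᵁ V ≤ U) (f : Γ(X, U))
    (x : Γ(M, hU.fromSpec ''ᵁ V)) :
    (show Γ(M.restrict hU.fromSpec, V) from f • (show Γ(M.restrict hU.fromSpec, V) from x)) =
      X.presheaf.map (homOfLE hV).op f • x := by
  have hc : (Scheme.ΓSpecIso Γ(X, U)).inv ≫ (Spec Γ(X, U)).presheaf.map V.leTop.op =
      X.presheaf.map (homOfLE hV).op ≫ (hU.fromSpec.appIso V).hom := by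
    rw [Scheme.Hom.appIso_hom', Scheme.Hom.map_appLE, Scheme.Hom.appLE, hU.fromSpec_app_self,
      Category.assoc, ← Functor.map_comp]
    rfl
  have := congr($hc ≫ (hU.fromSpec.appIso V).inv)
  rw [Category.assoc, Category.assoc, Iso.hom_inv_id, Category.comp_id] at this
  have hring : (hU.fromSpec.appIso V).inv ((Spec Γ(X, U)).presheaf.map V.leTop.op
      ((Scheme.ΓSpecIso Γ(X, U)).inv f)) = X.presheaf.map (homOfLE hV).op f := congr($this f)
  rw [← hring]
  rfl

lemma fromSpec_image_top {U : X.Opens} (hU : IsAffineOpen U) : hU.fromSpec ''ᵁ ⊤ = U := by simp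

/-- The sections of a module over an affine open `U`, as global sections of its restriction to the
spectrum of `Γ(X, U)`. -/
def sectionsEquiv {U : X.Opens} (hU : IsAffineOpen U) (M : X.Modules) :
    (moduleSpecΓFunctor (R := Γ(X, U))).obj (M.restrict hU.fromSpec) ≃ₗ[Γ(X, U)] Γ(M, U) where
  toFun x := M.presheaf.map (homOfLE (fromSpec_image_top hU).ge).op
    (show Γ(M, hU.fromSpec ''ᵁ ⊤) from x)
  invFun y := (show Γ(M, hU.fromSpec ''ᵁ ⊤) from
    M.presheaf.map (homOfLE (fromSpec_image_top hU).le).op y)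
  map_add' x y := map_add _ _ _
  map_smul' f x := by
    refine (congrArg _ (smul_restrict_fromSpec hU M ⊤ (fromSpec_image_top hU).le f x)).trans ?_
    refine (Scheme.Modules.map_smul M (homOfLE (fromSpec_image_top hU).ge) _ _).trans ?_
    congr 1
    rw [← ConcreteCategory.comp_apply, ← Functor.map_comp]
    exact congr($(X.presheaf.map_id (op U)) f)
  left_inv x := (modules_map_map M _ _ _).trans (modules_map_rfl M _ _)
  right_inv y := (modules_map_map M _ _ _).trans (modules_map_rfl M _ _)

lemma sectionsEquiv_naturality {U : X.Opens} (hU : IsAffineOpen U) {M N : X.Modules} (p : M ⟶ N)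
    (x : (moduleSpecΓFunctor (R := Γ(X, U))).obj (M.restrict hU.fromSpec)) :
    sectionsEquiv hU N ((moduleSpecΓFunctor (R := Γ(X, U))).map
      ((Scheme.Modules.restrictFunctor hU.fromSpec).map p) x) = p.app U (sectionsEquiv hU M x) :=
  (modules_app_map p _ _).symm

/-- Restriction along an open immersion is a left adjoint, so it preserves coproducts, and it sends
the structure sheaf to the structure sheaf. -/
lemma free_iso_restrict {Y : Scheme.{u}} (f : Y ⟶ X) [IsOpenImmersion f] {M : X.Modules}
    {I : Type u} (e : SheafOfModules.free I ≅ M) :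
    Nonempty (SheafOfModules.free I ≅ M.restrict f) := by
  let F : SheafOfModules X.ringCatSheaf ⥤ SheafOfModules Y.ringCatSheaf :=
    Scheme.Modules.restrictFunctor f
  have : PreservesColimitsOfSize.{u, u} F :=
    (Scheme.Modules.restrictAdjunction f).leftAdjoint_preservesColimits
  have : PreservesColimitsOfSize.{0, 0} F := preservesColimitsOfSize_shrink F
  exact ⟨SheafOfModules.mapFreeIso F I (Scheme.Modules.restrictUnitIso f).symm ≪≫ F.mapIso e⟩

lemma free_iso_restrict_of_over {V : X.Opens} {M : X.Modules} {I : Type u}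
    (e : SheafOfModules.free I ≅ SheafOfModules.over (R := X.ringCatSheaf) M V) :
    Nonempty (SheafOfModules.free I ≅ M.restrict V.ι) := by
  let F : SheafOfModules (X.ringCatSheaf.over V) ⥤
      SheafOfModules (V : Scheme.{u}).ringCatSheaf := (Scheme.Modules.overEquiv V).functor
  have : PreservesColimitsOfSize.{u, u} F :=
    (Scheme.Modules.overEquiv V).toAdjunction.leftAdjoint_preservesColimits
  have : PreservesColimitsOfSize.{0, 0} F := preservesColimitsOfSize_shrink F
  let η : F.obj (SheafOfModules.unit _) ≅ SheafOfModules.unit _ :=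
    (Scheme.Modules.overFunctorEquiv V).app (SheafOfModules.unit X.ringCatSheaf) ≪≫
      Scheme.Modules.restrictUnitIso V.ι
  exact ⟨SheafOfModules.mapFreeIso F I η.symm ≪≫ F.mapIso e ≪≫
    (Scheme.Modules.overFunctorEquiv V).app M⟩

lemma exists_free_iso_over (M : X.Modules)
    (hM : SheafOfModules.IsLocallyFree (R := X.ringCatSheaf) M) (x : X) :
    ∃ (V : X.Opens) (I : Type u), x ∈ V ∧
      Nonempty (SheafOfModules.free I ≅ SheafOfModules.over (R := X.ringCatSheaf) M V) := by
  have ⟨q, hq⟩ := hM.exists_isLocallyFreeData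
  have cov := (Opens.coversTop_iff _ _).mp q.coversTop
  have ⟨i, hi⟩ := TopologicalSpace.Opens.mem_iSup.mp (cov.iSup_eq_top.ge (Set.mem_univ x))
  have h := hq.isIso i
  exact ⟨q.X i, (q.generators i).I, hi, ⟨@asIso _ _ _ _ (q.generators i).π h⟩⟩

lemma free_iso_restrict_fromSpec {U V : X.Opens} (hU : IsAffineOpen U) (hUV : U ≤ V)
    {M : X.Modules} {I : Type u} (e : SheafOfModules.free I ≅ M.restrict V.ι) :
    Nonempty (SheafOfModules.free I ≅ M.restrict hU.fromSpec) := by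
  have hu : (hU.isoSpec.inv ≫ X.homOfLE hUV) ≫ V.ι = hU.fromSpec := by
    rw [Category.assoc, Scheme.homOfLE_ι, hU.isoSpec_inv_ι]
  obtain ⟨b⟩ := free_iso_restrict (hU.isoSpec.inv ≫ X.homOfLE hUV) e
  exact ⟨b ≪≫ ((Scheme.Modules.restrictFunctorComp _ V.ι).symm ≪≫
    Scheme.Modules.restrictFunctorCongr hu).app M⟩

/-- A locally free module restricts to a free one on small affine opens. -/
lemma exists_free_iso_restrict (M : X.Modules)
    (hM : SheafOfModules.IsLocallyFree (R := X.ringCatSheaf) M) (x : X) :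
    ∃ (U : X.Opens) (hU : IsAffineOpen U) (I : Type u), x ∈ U ∧
      Nonempty (SheafOfModules.free I ≅ M.restrict hU.fromSpec) := by
  obtain ⟨V, I, hxV, ⟨e⟩⟩ := exists_free_iso_over M hM x
  obtain ⟨e'⟩ := free_iso_restrict_of_over e
  obtain ⟨U, hU, hxU, hUV⟩ := TopologicalSpace.Opens.isBasis_iff_nbhd.mp X.isBasis_affineOpens hxV
  exact ⟨U, hU, I, hxU, free_iso_restrict_fromSpec hU hUV e'⟩

/-- An epimorphism from a sum of two quasi-coherent modules onto a locally free module has sections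
on small affine opens. -/
lemma exists_section {M M' N : X.Modules} (hN : SheafOfModules.IsLocallyFree (R := X.ringCatSheaf) N)
    (p : M ⊞ M' ⟶ N) [Epi p] [M.IsQuasicoherent] [M'.IsQuasicoherent] (x : X) :
    ∃ U : X.AffineZariskiSite, x ∈ U.toOpens ∧
      ∃ s : Γ(N, U.toOpens) →ₗ[Γ(X, U.toOpens)] Γ(M ⊞ M', U.toOpens),
        modMap p U.toOpens ∘ₗ s = LinearMap.id := by
  obtain ⟨U, hU, I, hx, ⟨e⟩⟩ := exists_free_iso_restrict N hN x
  refine ⟨⟨U, hU⟩, hx, ?_⟩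
  let F := Scheme.Modules.restrictFunctor hU.fromSpec
  have : PreservesColimitsOfSize.{0, 0} F :=
    (Scheme.Modules.restrictAdjunction hU.fromSpec).leftAdjoint_preservesColimits
  have : PreservesBinaryBiproducts F := preservesBinaryBiproducts_of_preservesBinaryCoproducts _
  have hM : IsIso (F.obj (M ⊞ M')).fromTildeΓ := by
    have := isIso_fromTildeΓ_biprod (M.restrict hU.fromSpec) (M'.restrict hU.fromSpec)
    rw [isIso_fromTildeΓ_iff] at this ⊢
    exact (tilde.functor _).essImage.prop_of_iso (F.mapBiprod M M').symm this
  have hN' : IsIso (F.obj N).fromTildeΓ := by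
    rw [isIso_fromTildeΓ_iff]
    exact ⟨_, ⟨tildeFinsupp I ≪≫ e⟩⟩
  have : Epi ((moduleSpecΓFunctor (R := Γ(X, U))).map (F.map p)) :=
    epi_moduleSpecΓFunctor_map (F.map p)
  have : Projective ((moduleSpecΓFunctor (R := Γ(X, U))).obj (F.obj N)) :=
    projective_moduleSpecΓFunctor_obj e
  -- On an affine scheme, global sections keep `p` surjective and turn the free module into a
  -- projective one, so the identity lifts through `p`.
  let s := Projective.factorThru (𝟙 _) ((moduleSpecΓFunctor (R := Γ(X, U))).map (F.map p))
  have hs : s ≫ (moduleSpecΓFunctor (R := Γ(X, U))).map (F.map p) = 𝟙 _ :=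
    Projective.factorThru_comp _ _
  refine ⟨(sectionsEquiv hU _).toLinearMap ∘ₗ s.hom ∘ₗ (sectionsEquiv hU N).symm.toLinearMap, ?_⟩
  ext y
  refine (sectionsEquiv_naturality hU p _).symm.trans ?_
  refine (congrArg (sectionsEquiv hU N) congr($hs ((sectionsEquiv hU N).symm y))).trans ?_
  exact (sectionsEquiv hU N).apply_symm_apply y

/-- Sections over any open preserve limits, hence kernels; affineness of `U` plays no role for this
half of the exactness. -/
lemma exact_sections {S : ShortComplex X.Modules} (hS : S.Exact) [Mono S.f] (U : X.Opens) :
    Function.Injective (modMap S.f U) ∧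
      ∀ x, modMap S.g U x = 0 → ∃ y, modMap S.f U y = x := by
  let F := Scheme.Modules.toPresheaf X ⋙ (evaluation _ _).obj (op U)
  have : F.Additive := ⟨rfl⟩
  have : PreservesLimitsOfSize.{0, 0} (Scheme.Modules.toPresheaf X) :=
    preservesLimitsOfSize_shrink _
  have : PreservesLimitsOfSize.{0, 0} F := ⟨fun {J} _ =>
    have : PreservesLimitsOfShape J
        ((evaluation (TopologicalSpace.Opens X)ᵒᵖ Ab.{u}).obj (op U)) :=
      evaluation_preservesLimitsOfShape _
    comp_preservesLimitsOfShape _ _⟩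
  have : Mono (F.map S.f) := inferInstance
  have h := hS.map_of_mono_of_preservesKernel F inferInstance inferInstance
  refine ⟨(AddCommGrpCat.mono_iff_injective (F.map S.f)).mp inferInstance, ?_⟩
  exact (ShortComplex.ab_exact_iff _).mp h

/-- The local splittings of the mapping cone of a quasi-isomorphism with locally free `M₀`. -/
lemma exists_split {N₁ N₀ M₁ M₀ : X.Modules} {d : N₁ ⟶ N₀} {d' : M₁ ⟶ M₀} {f₁ : N₁ ⟶ M₁}
    {f₀ : N₀ ⟶ M₀} (w : d ≫ f₀ = f₁ ≫ d') [IsIso (cokernel.map d d' f₁ f₀ w)]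
    [IsIso (kernel.map d d' f₁ f₀ w)] [N₀.IsQuasicoherent] [M₁.IsQuasicoherent]
    (hM₀ : SheafOfModules.IsLocallyFree (R := X.ringCatSheaf) M₀) (x : X) :
    ∃ U : X.AffineZariskiSite, x ∈ U.toOpens ∧
      ∃ (s : Γ(M₀, U.toOpens) →ₗ[Γ(X, U.toOpens)] Γ(N₀ ⊞ M₁, U.toOpens))
        (r : Γ(N₀ ⊞ M₁, U.toOpens) →ₗ[Γ(X, U.toOpens)] Γ(N₁, U.toOpens)),
        modMap (biprod.lift d f₁) U.toOpens ∘ₗ r =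
          LinearMap.id - s ∘ₗ modMap (biprod.desc f₀ (-d')) U.toOpens ∧
        r ∘ₗ modMap (biprod.lift d f₁) U.toOpens = LinearMap.id := by
  have := epi_desc_of_isIso_cokernelMap w
  obtain ⟨U, hx, s, hs⟩ := exists_section hM₀ (biprod.desc f₀ (-d')) x
  refine ⟨U, hx, s, ?_⟩
  have := mono_lift_of_isIso_kernelMap w
  obtain ⟨hinj, hex⟩ := exact_sections (exact_lift_desc w) U.toOpens
  dsimp at hinj hex
  set i := modMap (biprod.lift d f₁) U.toOpens
  set p := modMap (biprod.desc f₀ (-d')) U.toOpens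
  have hs' (y) : p (s y) = y := LinearMap.congr_fun hs y
  have hpi (y) : p (i y) = 0 := by
    have h : biprod.lift d f₁ ≫ biprod.desc f₀ (-d') = 0 := by simp [w]
    exact congr(($h).app U.toOpens y)
  -- The projector $1-sp$ takes values in $\ker p$, which is the image of the injective map $i$ by
  -- left exactness of sections; inverting $i$ there gives the retraction.
  let k := (LinearMap.id - s ∘ₗ p).codRestrict (LinearMap.range i) (fun y => hex _ (by simp [hs']))
  let e := LinearEquiv.ofInjective i hinj
  have he (y) : i (e.symm y) = y := congrArg Subtype.val (e.apply_symm_apply y)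
  refine ⟨e.symm.toLinearMap ∘ₗ k, ?_, ?_⟩
  · ext y
    exact he _
  · ext y
    apply hinj
    refine (he _).trans ?_
    change i y - s (p (i y)) = i y
    rw [hpi, map_zero, sub_zero]

end AlgebraicGeometry

/-! ### Preimages of closed subschemes, cones and invariance under the additive action. -/

namespace AlgebraicGeometry
open Opposite

variable {X : Scheme.{u}}

lemma modMap_comp_apply {M N P : X.Modules} (φ : M ⟶ N) (ψ : N ⟶ P) (U : X.Opens) (x : Γ(M, U)) :
    modMap ψ U (modMap φ U x) = modMap (φ ≫ ψ) U x := rfl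

/-- A morphism of modules has retractions on sections over small affine opens. -/
def HasLocalRetractions {M N : X.Modules} (φ : M ⟶ N) : Prop :=
  ∀ x : X, ∃ U : X.AffineZariskiSite, x ∈ U.toOpens ∧
    ∃ r : Γ(N, U.toOpens) →ₗ[Γ(X, U.toOpens)] Γ(M, U.toOpens),
      r ∘ₗ modMap φ U.toOpens = LinearMap.id

/-- For $\varphi$ dual to $q$ this makes $\mathrm{id}\times q$ suitable for testing inclusions, as
needed in `isInvariant_of_symPull_lift_eq`. -/
lemma HasLocalRetractions.biprod_map_id {M N P : X.Modules} {φ : M ⟶ N} (hφ : HasLocalRetractions φ) :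
    HasLocalRetractions (biprod.map (𝟙 P) φ) := by
  intro x
  obtain ⟨U, hx, r, hr⟩ := hφ x
  refine ⟨U, hx, modMap biprod.inl _ ∘ₗ modMap biprod.fst _ +
    modMap biprod.inr _ ∘ₗ r ∘ₗ modMap biprod.snd _, ?_⟩
  ext y
  have h₁ := LinearMap.congr_fun hr (modMap biprod.snd _ y)
  rw [LinearMap.comp_apply, modMap_comp_apply] at h₁
  have h₂ : modMap (biprod.inl : P ⟶ P ⊞ M) U.toOpens (modMap biprod.fst U.toOpens y) +
      modMap (biprod.inr : M ⟶ P ⊞ M) U.toOpens (modMap biprod.snd U.toOpens y) = y :=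
    congr(($(biprod.total (X := P) (Y := M))).app U.toOpens y)
  simp only [LinearMap.comp_apply, LinearMap.add_apply, LinearMap.id_apply] at h₁ ⊢
  rw [modMap_comp_apply (biprod.map (𝟙 P) φ) biprod.fst, modMap_comp_apply _ biprod.snd,
    biprod.map_fst, biprod.map_snd, Category.comp_id, h₁, h₂]

section Pull

variable {M N P : X.Modules} [IsLocalizingModule M] [IsLocalizingModule N] [IsLocalizingModule P]

/-- The preimage of a closed subscheme of `Spec_X (Sym M)` under the morphism induced by `M ⟶ N`. -/
def symPull (φ : M ⟶ N) (C : (symSpec M).left.IdealSheafData) : (symSpec N).left.IdealSheafData :=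
  C.comap (symSpecMap φ).left

lemma symPull_comp (φ : M ⟶ N) (ψ : N ⟶ P) (C : (symSpec M).left.IdealSheafData) :
    symPull (φ ≫ ψ) C = symPull ψ (symPull φ C) := by
  have h : (symSpecMap (φ ≫ ψ)).left = (symSpecMap ψ).left ≫ (symSpecMap φ).left :=
    congrArg CommaMorphism.left (symSpecMap_comp φ ψ)
  exact (congrArg C.comap h).trans (Scheme.IdealSheafData.comap_comp C _ _)

lemma symPull_id (C : (symSpec M).left.IdealSheafData) : symPull (𝟙 M) C = C := by
  have h : (symSpecMap (𝟙 M)).left = 𝟙 _ := congrArg CommaMorphism.left (symSpecMap_id M)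
  exact (congrArg C.comap h).trans (Scheme.IdealSheafData.comap_id C)

lemma symPull_mono (φ : M ⟶ N) {C C' : (symSpec M).left.IdealSheafData} (h : C ≤ C') :
    symPull φ C ≤ symPull φ C' :=
  Scheme.IdealSheafData.comap_mono _ h

lemma symIdeal_symPull (φ : M ⟶ N) (C : (symSpec M).left.IdealSheafData)
    (U : X.AffineZariskiSite) :
    symIdeal (symPull φ C) U = (symIdeal C U).map (symLin (modMap φ U.toOpens)) :=
  symIdeal_comap φ C U

lemma symIdeal_mono {C C' : (symSpec M).left.IdealSheafData} (h : C ≤ C')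
    (U : X.AffineZariskiSite) : symIdeal C U ≤ symIdeal C' U :=
  specIdeal_le_iff.mpr (Scheme.IdealSheafData.comap_mono _ h)

lemma le_of_forall_exists_symIdeal_le {C C' : (symSpec M).left.IdealSheafData}
    (h : ∀ x : X, ∃ U : X.AffineZariskiSite, x ∈ U.toOpens ∧ symIdeal C U ≤ symIdeal C' U) :
    C ≤ C' := by
  choose U hU h using h
  exact le_of_symIdeal_le U
    (top_le_iff.mp fun x _ => TopologicalSpace.Opens.mem_iSup.mpr ⟨x, hU x⟩) h

/-- Inclusion of ideal sheaves is local on $X$, and locally extending further along a retraction $r$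
undoes the extension along $\varphi$. -/
lemma HasLocalRetractions.symPull_le_iff {φ : M ⟶ N} (hφ : HasLocalRetractions φ)
    {C C' : (symSpec M).left.IdealSheafData} : symPull φ C ≤ symPull φ C' ↔ C ≤ C' := by
  refine ⟨fun h => le_of_forall_exists_symIdeal_le fun x => ?_, symPull_mono φ⟩
  obtain ⟨U, hx, r, hr⟩ := hφ x
  refine ⟨U, hx, ?_⟩
  have := Ideal.map_mono (f := symLin r) (symIdeal_mono h U)
  rwa [symIdeal_symPull, symIdeal_symPull, map_symLin_map, map_symLin_map, hr, symLin_id,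
    Ideal.map_id, Ideal.map_id] at this

lemma HasLocalRetractions.symPull_injective {φ : M ⟶ N} (hφ : HasLocalRetractions φ) :
    Function.Injective (symPull φ) := fun _ _ h =>
  le_antisymm (hφ.symPull_le_iff.mp h.le) (hφ.symPull_le_iff.mp h.ge)

/-- The cones in `Spec_X (Sym M)`. -/
def IsSymCone (C : (symSpec M).left.IdealSheafData) : Prop :=
  ∀ U : X.AffineZariskiSite, SymmetricAlgebra.IsConeIdeal (symIdeal C U)

lemma IsSymCone.symPull {C : (symSpec M).left.IdealSheafData} (hC : IsSymCone C) (φ : M ⟶ N) :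
    IsSymCone (symPull φ C) := fun U => by
  rw [symIdeal_symPull]
  exact (hC U).map _

lemma IsSymCone.map {C : (symSpec N).left.IdealSheafData} (hC : IsSymCone C) (φ : M ⟶ N) :
    IsSymCone (C.map (symSpecMap φ).left) := fun U => by
  rw [symIdeal_map]
  exact (hC U).comap _

end Pull

lemma hasLocalRetractions_lift {N₁ N₀ M₁ M₀ : X.Modules} {d : N₁ ⟶ N₀} {d' : M₁ ⟶ M₀}
    {f₁ : N₁ ⟶ M₁} {f₀ : N₀ ⟶ M₀} (w : d ≫ f₀ = f₁ ≫ d') [N₀.IsQuasicoherent] [M₁.IsQuasicoherent]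
    [IsIso (cokernel.map d d' f₁ f₀ w)] [IsIso (kernel.map d d' f₁ f₀ w)]
    (hM₀ : SheafOfModules.IsLocallyFree (R := X.ringCatSheaf) M₀) :
    HasLocalRetractions (biprod.lift d f₁) := fun x =>
  have ⟨U, hx, _, r, _, hr⟩ := exists_split w hM₀ x
  ⟨U, hx, r, hr⟩

section Cones

variable {N₁ N₀ M₁ M₀ : X.Modules} [IsLocalizingModule N₁] [IsLocalizingModule N₀]
  [IsLocalizingModule M₁] [IsLocalizingModule M₀] {d : N₁ ⟶ N₀} {d' : M₁ ⟶ M₀} {f₁ : N₁ ⟶ M₁}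
  {f₀ : N₀ ⟶ M₀}

/-- The closed subscheme `C` of `L(N₁)` is invariant under the action of `L(N₀)` through `d`. -/
def IsInvariant (d : N₁ ⟶ N₀) (C : (symSpec N₁).left.IdealSheafData) : Prop :=
  symPull (biprod.lift d (𝟙 N₁)) C ≤ symPull (biprod.inr : N₁ ⟶ N₀ ⊞ N₁) C

/-- A group action has inverses: the involution $(e,f)\mapsto(-e,De+f)$, dual to `σ`, exchanges the
action map and the second projection, and so reverses the inclusion. -/
lemma IsInvariant.symPull_eq {C : (symSpec N₁).left.IdealSheafData} (hC : IsInvariant d C) :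
    symPull (biprod.lift d (𝟙 N₁)) C = symPull (biprod.inr : N₁ ⟶ N₀ ⊞ N₁) C := by
  refine le_antisymm hC ?_
  let σ : N₀ ⊞ N₁ ⟶ N₀ ⊞ N₁ := biprod.desc (-biprod.inl) (biprod.lift d (𝟙 N₁))
  have h₁ : biprod.inr ≫ σ = biprod.lift d (𝟙 N₁) := biprod.inr_desc _ _
  have h₂ : biprod.lift d (𝟙 N₁) ≫ σ = biprod.inr := by
    apply biprod.hom_ext <;> simp [σ, biprod.lift_desc]
  have := symPull_mono σ hC
  rwa [← symPull_comp, ← symPull_comp, h₁, h₂] at this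

/-- $\Phi_1$ is equivariant along $\Phi_0$: both the action maps and the projections commute with
$\Phi_0\times\Phi_1$. -/
lemma IsInvariant.symPull (w : d ≫ f₀ = f₁ ≫ d') {C : (symSpec N₁).left.IdealSheafData}
    (hC : IsInvariant d C) : IsInvariant d' (symPull f₁ C) := by
  have h₁ : f₁ ≫ biprod.lift d' (𝟙 M₁) = biprod.lift d (𝟙 N₁) ≫ biprod.map f₀ f₁ := by
    apply biprod.hom_ext <;> simp [w]
  have h₂ : f₁ ≫ (biprod.inr : M₁ ⟶ M₀ ⊞ M₁) = biprod.inr ≫ biprod.map f₀ f₁ := by simp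
  rw [IsInvariant, ← symPull_comp, ← symPull_comp, h₁, h₂, symPull_comp, symPull_comp]
  exact symPull_mono _ hC

/-- Here $q$ is the action map $\alpha$ of $E_0$ on $E_1$ composed with $\mathrm{id}\times\Phi_1$,
and $\alpha^{-1}(C)=E_0\oplus C$ by invariance. -/
lemma IsInvariant.symPull_lift {C : (symSpec N₁).left.IdealSheafData} (hC : IsInvariant d C)
    (f₁ : N₁ ⟶ M₁) : AlgebraicGeometry.symPull (biprod.lift d f₁) C =
      AlgebraicGeometry.symPull (biprod.inr : M₁ ⟶ N₀ ⊞ M₁) (AlgebraicGeometry.symPull f₁ C) := by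
  have h₁ : biprod.lift d f₁ = biprod.lift d (𝟙 N₁) ≫ biprod.map (𝟙 N₀) f₁ := by
    apply biprod.hom_ext <;> simp
  have h₂ : f₁ ≫ (biprod.inr : M₁ ⟶ N₀ ⊞ M₁) = biprod.inr ≫ biprod.map (𝟙 N₀) f₁ := by simp
  rw [← symPull_comp, h₁, h₂, symPull_comp, symPull_comp, hC.symPull_eq]

/-- It suffices to compare preimages under $\mathrm{id}\times q$ in $E_0\oplus E_0\oplus F_1$. There
the action becomes $(e,e',f)\mapsto q(e+e',f)$, and since $q^{-1}(D)=E_0\oplus C$ ignores the first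
coordinate, both preimages equal $E_0\oplus E_0\oplus C$. -/
lemma isInvariant_of_symPull_lift_eq (hι : HasLocalRetractions (biprod.lift d f₁))
    {D : (symSpec N₁).left.IdealSheafData} {C : (symSpec M₁).left.IdealSheafData}
    (h : symPull (biprod.lift d f₁) D = symPull (biprod.inr : M₁ ⟶ N₀ ⊞ M₁) C) :
    IsInvariant d D := by
  let ι := biprod.lift d f₁
  have h₁ : biprod.lift d (𝟙 N₁) ≫ biprod.map (𝟙 N₀) ι =
      ι ≫ biprod.lift biprod.fst (𝟙 (N₀ ⊞ M₁)) := by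
    apply biprod.hom_ext <;> simp [ι]
  have h₂ : (biprod.inr : M₁ ⟶ N₀ ⊞ M₁) ≫ biprod.lift biprod.fst (𝟙 (N₀ ⊞ M₁)) =
      biprod.inr ≫ biprod.inr := by
    apply biprod.hom_ext <;> simp
  have h₃ : ι ≫ biprod.inr = (biprod.inr : N₁ ⟶ N₀ ⊞ N₁) ≫ biprod.map (𝟙 N₀) ι := by simp
  rw [IsInvariant, ← (hι.biprod_map_id (P := N₀)).symPull_le_iff, ← symPull_comp, h₁,
    symPull_comp, h, ← symPull_comp, h₂, symPull_comp, ← h, ← symPull_comp, h₃, symPull_comp]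

/-- The restriction of $q$ to $0\oplus F_1$ is $\Phi_1$, while $E_0\oplus C$ restricts to $C$. -/
lemma symPull_eq_of_symPull_lift_eq
    {D : (symSpec N₁).left.IdealSheafData} {C : (symSpec M₁).left.IdealSheafData}
    (h : symPull (biprod.lift d f₁) D = symPull (biprod.inr : M₁ ⟶ N₀ ⊞ M₁) C) :
    symPull f₁ D = C := by
  rw [← biprod.lift_snd d f₁, symPull_comp, h, ← symPull_comp, biprod.inr_snd, symPull_id]

/-- The push-forward of an invariant closed subscheme along a quasi-isomorphism. -/
lemma symPull_map_eq (w : d ≫ f₀ = f₁ ≫ d') [N₀.IsQuasicoherent] [M₁.IsQuasicoherent]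
    [IsIso (cokernel.map d d' f₁ f₀ w)] [IsIso (kernel.map d d' f₁ f₀ w)]
    (hM₀ : SheafOfModules.IsLocallyFree (R := X.ringCatSheaf) M₀)
    {C : (symSpec M₁).left.IdealSheafData} (hC : IsInvariant d' C) :
    symPull (biprod.lift d f₁) ((symPull (biprod.inr : M₁ ⟶ N₀ ⊞ M₁) C).map
      (symSpecMap (biprod.lift d f₁)).left) = symPull (biprod.inr : M₁ ⟶ N₀ ⊞ M₁) C := by
  -- One inclusion is the counit of the adjunction between pull-back and push-forward; the other is
  -- local and uses the splitting together with invariance.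
  refine le_antisymm (Scheme.IdealSheafData.comap_map_le _ _) ?_
  refine le_of_forall_exists_symIdeal_le fun x => ?_
  obtain ⟨U, hx, s, r, hr, -⟩ := exists_split w hM₀ x
  refine ⟨U, hx, ?_⟩
  have hI := symIdeal_mono hC U
  rw [symIdeal_symPull, symIdeal_symPull] at hI
  rw [symIdeal_symPull, symIdeal_symPull, symIdeal_map, symIdeal_symPull]
  refine map_le_map_comap_of_invariant _ _ s r hr _ (modMap d' U.toOpens) ?_
    (modMap (biprod.inl : M₀ ⟶ M₀ ⊞ M₁) U.toOpens) (modMap (biprod.inr : M₁ ⟶ M₀ ⊞ M₁) U.toOpens)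
    (modMap biprod.fst U.toOpens) (modMap biprod.snd U.toOpens) ?_ ?_ ?_ ?_ _ ?_
  · ext y
    exact congr(($(biprod.inr_desc f₀ (-d'))).app U.toOpens y)
  · ext y
    exact congr(($(biprod.inl_fst (X := M₀) (Y := M₁))).app U.toOpens y)
  · ext y
    exact congr(($(biprod.inl_snd (X := M₀) (Y := M₁))).app U.toOpens y)
  · ext y
    exact congr(($(biprod.inr_fst (X := M₀) (Y := M₁))).app U.toOpens y)
  · ext y
    exact congr(($(biprod.inr_snd (X := M₀) (Y := M₁))).app U.toOpens y)
  · have h : biprod.lift d' (𝟙 M₁) = d' ≫ biprod.inl + biprod.inr := by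
      apply biprod.hom_ext <;> simp
    rw [h] at hI
    exact hI

end Cones

/-! ### Going up and going down along a quasi-isomorphism. -/

namespace TwoTermComplex

variable {G F E : TwoTermComplex X} {Φ : F ⟶ E}

lemma IsQuasiIso.id (F : TwoTermComplex X) : IsQuasiIso (𝟙 F) := by
  constructor
  · have : cokernel.map F.hom.dual F.hom.dual (𝟙 F : F ⟶ F).right.dual (𝟙 F : F ⟶ F).left.dual
        (dual_w (𝟙 F)) = 𝟙 _ := by
      rw [← cancel_epi (cokernel.π _), cokernel.π_desc, Category.comp_id]
      exact Category.id_comp _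
    rw [this]
    infer_instance
  · have : kernel.map F.hom.dual F.hom.dual (𝟙 F : F ⟶ F).right.dual (𝟙 F : F ⟶ F).left.dual
        (dual_w (𝟙 F)) = 𝟙 _ := by
      rw [← cancel_mono (kernel.ι _), kernel.lift_ι, Category.id_comp]
      exact Category.comp_id _
    rw [this]
    infer_instance

lemma IsQuasiIso.comp {Ψ : G ⟶ F} (hΨ : IsQuasiIso Ψ) (hΦ : IsQuasiIso Φ) :
    IsQuasiIso (Ψ ≫ Φ) := by
  obtain ⟨_, _⟩ := hΨ
  obtain ⟨_, _⟩ := hΦ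
  constructor
  · have : cokernel.map E.hom.dual G.hom.dual (Ψ ≫ Φ).right.dual (Ψ ≫ Φ).left.dual
        (dual_w (Ψ ≫ Φ)) = cokernel.map _ _ _ _ (dual_w Φ) ≫ cokernel.map _ _ _ _ (dual_w Ψ) := by
      rw [← cancel_epi (cokernel.π _), cokernel.π_desc, cokernel.π_desc_assoc, Category.assoc,
        cokernel.π_desc, ← Category.assoc]
      rfl
    rw [this]
    infer_instance
  · have : kernel.map E.hom.dual G.hom.dual (Ψ ≫ Φ).right.dual (Ψ ≫ Φ).left.dual
        (dual_w (Ψ ≫ Φ)) = kernel.map _ _ _ _ (dual_w Φ) ≫ kernel.map _ _ _ _ (dual_w Ψ) := by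
      rw [← cancel_mono (kernel.ι _), kernel.lift_ι, Category.assoc, kernel.lift_ι,
        kernel.lift_ι_assoc, Category.assoc]
      rfl
    rw [this]
    infer_instance

lemma isPushForward_iff {C : F.right.ClosedSubscheme} {D : E.right.ClosedSubscheme} :
    IsPushForward Φ C D ↔ IsSymCone D ∧ symPull (biprod.lift E.hom.dual Φ.right.dual) D =
      symPull (biprod.inr : F.right.sheaf ⟶ E.left.sheaf ⊞ F.right.sheaf) C :=
  Iff.rfl

lemma goUp_mem_cones {D : E.right.ClosedSubscheme} (hD : D ∈ cones E) : goUp Φ D ∈ cones F :=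
  ⟨IsSymCone.symPull hD.1 _, IsInvariant.symPull (dual_w Φ) hD.2⟩

/-- Once push-forwards are unique, this says that going down inverts going up. -/
lemma isPushForward_goUp {D : E.right.ClosedSubscheme} (hD : D ∈ cones E) :
    IsPushForward Φ (goUp Φ D) D :=
  ⟨hD.1, IsInvariant.symPull_lift hD.2 _⟩

lemma IsPushForward.goUp_eq {C : F.right.ClosedSubscheme} {D : E.right.ClosedSubscheme}
    (h : IsPushForward Φ C D) : goUp Φ D = C :=
  symPull_eq_of_symPull_lift_eq (isPushForward_iff.mp h).2

lemma goUp_id (C : F.right.ClosedSubscheme) : goUp (𝟙 F) C = C :=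
  symPull_id C

lemma goUp_comp (Ψ : G ⟶ F) (C : E.right.ClosedSubscheme) :
    goUp (Ψ ≫ Φ) C = goUp Ψ (goUp Φ C) :=
  symPull_comp Φ.right.dual Ψ.right.dual C

section QuasiIso

variable (hΦ : IsQuasiIso Φ) (hF : F.left.IsVectorBundle)
include hΦ hF

lemma IsQuasiIso.hasLocalRetractions :
    HasLocalRetractions (biprod.lift E.hom.dual Φ.right.dual) := by
  obtain ⟨_, _⟩ := hΦ
  exact hasLocalRetractions_lift (dual_w Φ) hF

lemma IsQuasiIso.exists_isPushForward {C : F.right.ClosedSubscheme} (hC : C ∈ cones F) :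
    ∃ D, IsPushForward Φ C D := by
  obtain ⟨_, _⟩ := hΦ
  -- The witness is the scheme-theoretic image of $E_0\oplus C$ under $q$.
  exact ⟨_, IsSymCone.map (IsSymCone.symPull hC.1 _) _, symPull_map_eq (dual_w Φ) hF hC.2⟩

lemma IsQuasiIso.isPushForward_goDown {C : F.right.ClosedSubscheme} (hC : C ∈ cones F) :
    IsPushForward Φ C (goDown Φ C) := by
  have h := hΦ.exists_isPushForward hF hC
  rw [goDown, dif_pos h]
  exact h.choose_spec

lemma IsQuasiIso.isPushForward_unique {C : F.right.ClosedSubscheme} {D D' : E.right.ClosedSubscheme}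
    (h : IsPushForward Φ C D) (h' : IsPushForward Φ C D') : D = D' :=
  (hΦ.hasLocalRetractions hF).symPull_injective (h.2.trans h'.2.symm)

lemma IsQuasiIso.goDown_mem_cones {C : F.right.ClosedSubscheme} (hC : C ∈ cones F) :
    goDown Φ C ∈ cones E := by
  have h := hΦ.isPushForward_goDown hF hC
  exact ⟨h.1, isInvariant_of_symPull_lift_eq (hΦ.hasLocalRetractions hF) h.2⟩

lemma IsQuasiIso.goUp_goDown {C : F.right.ClosedSubscheme} (hC : C ∈ cones F) :
    goUp Φ (goDown Φ C) = C :=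
  (hΦ.isPushForward_goDown hF hC).goUp_eq

lemma IsQuasiIso.goDown_goUp {D : E.right.ClosedSubscheme} (hD : D ∈ cones E) :
    goDown Φ (goUp Φ D) = D :=
  hΦ.isPushForward_unique hF (hΦ.isPushForward_goDown hF (goUp_mem_cones hD))
    (isPushForward_goUp hD)

end QuasiIso

end TwoTermComplex

end AlgebraicGeometry

end

theorem mainTheorem5 {k : Type u} [Field k] {X : Scheme.{u}} (s : X ⟶ Spec (CommRingCat.of k))
    [LocallyOfFiniteType s] [QuasiCompact s]
    {F E : TwoTermComplex X} (Φ : F ⟶ E) (hΦ : TwoTermComplex.IsQuasiIso Φ)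
    (hF : F.left.IsVectorBundle) :
    -- going down is well defined: the push-forward exists and is unique
    (∀ C ∈ TwoTermComplex.cones F,
      TwoTermComplex.IsPushForward Φ C (TwoTermComplex.goDown Φ C) ∧
      ∀ D, TwoTermComplex.IsPushForward Φ C D → D = TwoTermComplex.goDown Φ C) ∧
    -- going down and going up are mutually inverse bijections
    Set.BijOn (TwoTermComplex.goDown Φ) (TwoTermComplex.cones F) (TwoTermComplex.cones E) ∧
    Set.BijOn (TwoTermComplex.goUp Φ) (TwoTermComplex.cones E) (TwoTermComplex.cones F) ∧
    Set.InvOn (TwoTermComplex.goUp Φ) (TwoTermComplex.goDown Φ)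
      (TwoTermComplex.cones F) (TwoTermComplex.cones E) ∧
    -- functoriality: identities and compositions
    (∀ C ∈ TwoTermComplex.cones F,
      TwoTermComplex.goUp (𝟙 F) C = C ∧ TwoTermComplex.goDown (𝟙 F) C = C) ∧
    (∀ (G : TwoTermComplex X) (Ψ : G ⟶ F), TwoTermComplex.IsQuasiIso Ψ → G.left.IsVectorBundle →
      (∀ C ∈ TwoTermComplex.cones E, TwoTermComplex.goUp (Ψ ≫ Φ) C =
        TwoTermComplex.goUp Ψ (TwoTermComplex.goUp Φ C)) ∧
      (∀ C ∈ TwoTermComplex.cones G, TwoTermComplex.goDown (Ψ ≫ Φ) C =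
        TwoTermComplex.goDown Φ (TwoTermComplex.goDown Ψ C))) := by
  have inv : Set.InvOn (TwoTermComplex.goUp Φ) (TwoTermComplex.goDown Φ)
      (TwoTermComplex.cones F) (TwoTermComplex.cones E) :=
    ⟨fun _ hC => hΦ.goUp_goDown hF hC, fun _ hD => hΦ.goDown_goUp hF hD⟩
  have down : Set.MapsTo (TwoTermComplex.goDown Φ) (TwoTermComplex.cones F)
      (TwoTermComplex.cones E) := fun _ hC => hΦ.goDown_mem_cones hF hC
  have up : Set.MapsTo (TwoTermComplex.goUp Φ) (TwoTermComplex.cones E)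
      (TwoTermComplex.cones F) := fun _ hD => TwoTermComplex.goUp_mem_cones hD
  refine ⟨fun C hC => ⟨hΦ.isPushForward_goDown hF hC, fun D hD =>
    hΦ.isPushForward_unique hF hD (hΦ.isPushForward_goDown hF hC)⟩, inv.bijOn down up,
    inv.symm.bijOn up down, inv, fun C hC => ⟨TwoTermComplex.goUp_id C, ?_⟩,
    fun G Ψ hΨ hG => ⟨fun C _ => TwoTermComplex.goUp_comp Ψ C, fun C hC => ?_⟩⟩
  -- Going up along the identity is trivial, so its inverse is trivial too.
  · have h := (TwoTermComplex.IsQuasiIso.id F).goDown_goUp hF hC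
    rwa [TwoTermComplex.goUp_id] at h
  · have hD := hΨ.goDown_mem_cones hG hC
    -- The composite going down inverts the composite going up, evaluated at the cone obtained by
    -- going down in two stages; the two stages of going up return that cone to `C`.
    have h := (hΨ.comp hΦ).goDown_goUp hG (hΦ.goDown_mem_cones hF hD)
    rwa [TwoTermComplex.goUp_comp, hΦ.goUp_goDown hF hD, hΨ.goUp_goDown hG hC] at h
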